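/- Let $a\ge 1$ be an integer. For a finite sequence $\mathbf k=(k_1,\dots,k_n)$ of positive integers that is admissible ($k_1\ge2$), define $$t_{2a,a}(\mathbf k)=\sum_{\substack{m_1>\cdots>m_n>0\\ m_i\equiv a\ (\mathrm{mod}\ 2a)}}\frac1{m_1^{k_1}\cdots m_n^{k_n}},\qquad t^\star_{2a,a}(\mathbf k)=\sum_{\substack{m_1\ge\cdots\ge m_n>0\\ m_i\equiv a\ (\mathrm{mod}\ 2a)}}\frac1{m_1^{k_1}\cdots m_n^{k_n}}.$$ These series converge. For $n\ge2$ put $t(n)=\sum_{m>0,\ m\ \mathrm{odd}}m^{-n}$. Let $G_{0,2a,a}(k,n)$ and $G^\star_{0,2a,a}(k,n)$ be the sums of $t_{2a,a}(\mathbf k)$, respectively $t^\star_{2a,a}(\mathbf k)$, over all admissible $\mathbf k$ with $k_1+\cdots+k_n=k$ and exactly $n$ entries. Then, as formal power series in $u$ with real coefficients, $$\sum_{k=2}^\infty\Bigl(\sum_{n=1}^{k-1}2^{n-1}G_{0,2a,a}(k,n)\Bigr)u^{k-2}=\sum_{k=2}^\infty\Bigl(\sum_{n=1}^{k-1}(-1)^{k-n-1}2^{n-1}G^\star_{0,2a,a}(k,n)\Bigr)u^{k-2}$$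 $$=a^{-2}\,2^{2u/a}\,t(2)\exp\Bigl(\sum_{n=2}^\infty\frac{4(2^{n-1}-1)}{n\,a^n(2^n-1)}t(n)u^n\Bigr),$$ where $2^{2u/a}=\exp\bigl(\tfrac{2\log 2}{a}u\bigr)$. Consequently, for every integer $k\ge2$, $$\sum_{n=1}^{k-1}2^{n-1}G_{0,2a,a}(k,n)=\sum_{n=1}^{k-1}(-1)^{k-n-1}2^{n-1}G^\star_{0,2a,a}(k,n)$$ $$=\sum_{\substack{n+n_1+\cdots+n_m=k-2\\ n,m\ge0,\ n_1,\dots,n_m\ge2}}\frac{2^{n+2m}(2^{n_1-1}-1)\cdots(2^{n_m-1}-1)}{a^k\,n!\,m!\,n_1\cdots n_m(2^{n_1}-1)\cdots(2^{n_m}-1)}\,t(2)\,t(n_1)\cdots t(n_m)\,\log^n 2.$$ -/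

import Mathlib

namespace MultipleT

/-- An index `(k₁, …, kₙ)` of depth `n` is a function `Fin n → ℕ` with positive entries. It is
admissible if moreover its first entry is at least `2` (no condition for the empty index). -/
def IsAdmissible {n : ℕ} (s : Fin n → ℕ) : Prop :=
  (∀ i, 1 ≤ s i) ∧ ∀ i : Fin n, i.val = 0 → 2 ≤ s i

instance {n : ℕ} (s : Fin n → ℕ) : Decidable (IsAdmissible s) := by
  unfold IsAdmissible
  infer_instance

/-- `I₀(k, n)`: the finite set of admissible indices of weight `k` and depth `n`. -/
def admissibleIndices (k n : ℕ) : Finset (Fin n → ℕ) :=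
  (Finset.Nat.antidiagonalTuple n k).filter fun s => IsAdmissible s

/-- Tuples `m₁ > ⋯ > mₙ > 0` with all `mᵢ ≡ a (mod N)`. -/
def strictTuples (N a n : ℕ) : Set (Fin n → ℕ) :=
  {m | StrictAnti m ∧ ∀ i, 0 < m i ∧ m i ≡ a [MOD N]}

/-- Tuples `m₁ ≥ ⋯ ≥ mₙ > 0` with all `mᵢ ≡ a (mod N)`. -/
def weakTuples (N a n : ℕ) : Set (Fin n → ℕ) :=
  {m | Antitone m ∧ ∀ i, 0 < m i ∧ m i ≡ a [MOD N]}

/-- The term `1 / (m₁ ^ k₁ ⋯ mₙ ^ kₙ)`. -/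
noncomputable def term {n : ℕ} (s m : Fin n → ℕ) : ℝ :=
  1 / ∏ i, (m i : ℝ) ^ s i

/-- The multiple `t`-value of level `N`, `t_{N,a}(k₁, …, kₙ)`. -/
noncomputable def tValue (N a : ℕ) {n : ℕ} (s : Fin n → ℕ) : ℝ :=
  ∑' m : strictTuples N a n, term s m.1

/-- The multiple `t`-star value of level `N`, `t⋆_{N,a}(k₁, …, kₙ)`. -/
noncomputable def tStarValue (N a : ℕ) {n : ℕ} (s : Fin n → ℕ) : ℝ :=
  ∑' m : weakTuples N a n, term s m.1

/-- The single `t`-value `t(n) = t_{2,1}(n)`, the sum of `1 / m ^ n` over odd `m > 0`. -/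
noncomputable def t (n : ℕ) : ℝ := tValue 2 1 ![n]

/-- `G_{0,N,a}(k, n)`: the sum of `t_{N,a}` over admissible indices of weight `k`, depth `n`. -/
noncomputable def G (N a k n : ℕ) : ℝ := ∑ s ∈ admissibleIndices k n, tValue N a s

/-- `G⋆_{0,N,a}(k, n)`: the sum of `t⋆_{N,a}` over admissible indices of weight `k`, depth `n`. -/
noncomputable def GStar (N a k n : ℕ) : ℝ := ∑ s ∈ admissibleIndices k n, tStarValue N a s

/-- The weighted sum `∑_{n=1}^{k-1} 2^{n-1} G_{0,2a,a}(k, n)`. -/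
noncomputable def weightedSum (a k : ℕ) : ℝ :=
  ∑ n ∈ Finset.Icc 1 (k - 1), 2 ^ (n - 1) * G (2 * a) a k n

/-- The weighted sum `∑_{n=1}^{k-1} (-1)^{k-n-1} 2^{n-1} G⋆_{0,2a,a}(k, n)`. -/
noncomputable def weightedStarSum (a k : ℕ) : ℝ :=
  ∑ n ∈ Finset.Icc 1 (k - 1), (-1) ^ (k - n - 1) * 2 ^ (n - 1) * GStar (2 * a) a k n

/-- The formal power series `∑_{k ≥ 2} c k u^{k-2}`. -/
noncomputable def genFun (c : ℕ → ℝ) : PowerSeries ℝ := PowerSeries.mk fun j => c (j + 2)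

/-- `exp f` for a formal power series `f` without constant term. -/
noncomputable def formalExp (f : PowerSeries ℝ) : PowerSeries ℝ := (PowerSeries.exp ℝ).subst f

/-- `x ^ (c u) = exp (c log x · u)` as a formal power series in `u`, for real `x > 0`. -/
noncomputable def formalPow (x c : ℝ) : PowerSeries ℝ :=
  formalExp (PowerSeries.C (c * Real.log x) * PowerSeries.X)

/-- The formal power series `∑_{n ≥ 2} 4 (2^{n-1} - 1) / (n aⁿ (2ⁿ - 1)) t(n) uⁿ`. -/
noncomputable def exponentSeries (a : ℕ) : PowerSeries ℝ :=
  PowerSeries.mk fun n =>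
    if 2 ≤ n then 4 * (2 ^ (n - 1) - 1) / (n * (a : ℝ) ^ n * (2 ^ n - 1)) * t n else 0

/-- For `k ≥ 2`, the finite sum over all `n, m ≥ 0` and `n₁, …, n_m ≥ 2` with
`n + n₁ + ⋯ + n_m = k - 2` (so that `n, m ≤ k - 2`) of
`2^{n+2m} ∏ (2^{nᵢ-1} - 1) / (a^k n! m! ∏ nᵢ ∏ (2^{nᵢ} - 1)) · t(2) ∏ t(nᵢ) · (log 2)ⁿ`. -/
noncomputable def explicitSum (a k : ℕ) : ℝ :=
  ∑ n ∈ Finset.range (k - 1), ∑ m ∈ Finset.range (k - 1),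
    ∑ p ∈ (Finset.Nat.antidiagonalTuple m (k - 2 - n)).filter fun p => ∀ i, 2 ≤ p i,
      2 ^ (n + 2 * m) * (∏ i, ((2 : ℝ) ^ (p i - 1) - 1)) /
          ((a : ℝ) ^ k * n.factorial * m.factorial * (∏ i, (p i : ℝ)) *
            ∏ i, ((2 : ℝ) ^ p i - 1)) *
        (t 2 * (∏ i, t (p i)) * Real.log 2 ^ n)

end MultipleT

/-!
Write the elements of the progression as `1 / x_j` with `x_j = 1 / (a (2 j + 1))`. For a fixed
largest index `j`, summing over all admissible indices and over all decreasing tuples starting at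
`j`, with weight `2 ^ (n - 1)` in depth `n` and `u ^ (k - 2)` in weight `k`, gives the finite product
`x_j ^ 2 / (1 - x_j u) * ∏_{i < j} (1 + x_i u) / (1 - x_i u)`, called `layer`. The weakly decreasing
tuples with the alternating weights give, at `-u`, the inverse factors for `i ≤ j`, and the extra
factor `i = j` turns the two series into each other. Hence the strict and the starred weighted sums
agree (`hasSum_weightedSum`, `hasSum_weightedStarSum`). Both kinds of tuples are treated at once as
chains with slack `b`, where `b` is `0` or `1`.

It remains to sum the layers. With `v = u / a` their sum is `a ^ (-2)` times the well-poised
hypergeometric value `hyperSum v`, which Dixon's theorem evaluates. Only the following special case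
is needed. A telescoping certificate gives the recurrence
`(2 - v) ^ 2 * hyperSum (v - 2) = (1 - v) ^ 2 * hyperSum v`, and summation by parts shows that
`-2 v * hyperSum v` has a finite limit as `v → -∞`, which is positive by the recurrence. Therefore
`hyperSum v / hyperSum 0` is the infinite product of
`((1 - v / (2 j + 2)) / (1 - v / (2 j + 1))) ^ 2` (`tendsto_prod_hyperSum`). The expansion of its
logarithm has as coefficients the alternating zeta values, namely `log 2` and multiples of `t n`
(`hyperSum_eq_exp`).

All power series involved have nonnegative coefficients, so sums may be interchanged freely for
small `u ≥ 0`, and the identity of values on `[0, 1 / 8]` is an identity of formal power series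
(`eq_of_hasSum_eq`). The explicit formula is the expansion of the two exponentials.
-/

namespace MultipleT

open Finset PowerSeries Filter Topology

/-! ### Sums over chains -/

/-- A tuple is a chain with slack `b` if `m j < m i + b` whenever `i < j`. Slack `0` gives the
strictly decreasing tuples and slack `1` the weakly decreasing ones. -/
def IsSlackChain (b : ℕ) {n : ℕ} (m : Fin n → ℕ) : Prop :=
  ∀ i j : Fin n, i < j → m j < m i + b

/-- Chains with slack `b` which can be prolonged to the left by the entry `j`. -/
def chainsBelow (b n j : ℕ) : Set (Fin n → ℕ) :=
  {m | (∀ i, m i < j + b) ∧ IsSlackChain b m}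

/-- The sum of `∏ i, g (m i) (s i)` over the chains `m` with slack `b` below `j`, organised as an
iterated sum. -/
def nestedSum (b : ℕ) (g : ℕ → ℕ → ℝ) : (n : ℕ) → (Fin n → ℕ) → ℕ → ℝ
  | 0, _, _ => 1
  | n + 1, s, j => ∑ i ∈ range (j + b), g i (s 0) * nestedSum b g n (Fin.tail s) i

lemma isSlackChain_cons {b n i : ℕ} {m : Fin n → ℕ} :
    IsSlackChain b (Fin.cons i m : Fin (n + 1) → ℕ) ↔ m ∈ chainsBelow b n i := by
  constructor
  · intro h
    refine ⟨fun l => by simpa using h 0 l.succ (Fin.succ_pos l), fun p q hpq => ?_⟩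
    simpa using h p.succ q.succ (by simpa using hpq)
  · rintro ⟨h1, h2⟩ p q hpq
    induction p using Fin.cases with
    | zero =>
      induction q using Fin.cases with
      | zero => simp at hpq
      | succ q => simpa using h1 q
    | succ p =>
      induction q using Fin.cases with
      | zero => simp at hpq
      | succ q => simpa using h2 p q (by simpa using hpq)

lemma cons_mem_chainsBelow {b n i j : ℕ} (hb : b ≤ 1) {m : Fin n → ℕ} :
    (Fin.cons i m : Fin (n + 1) → ℕ) ∈ chainsBelow b (n + 1) j ↔
      i < j + b ∧ m ∈ chainsBelow b n i := by
  change (∀ _, _) ∧ _ ↔ _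
  rw [isSlackChain_cons, Fin.forall_fin_succ]
  simp only [Fin.cons_zero, Fin.cons_succ]
  constructor
  · rintro ⟨⟨h1, -⟩, h2⟩
    exact ⟨h1, h2⟩
  · rintro ⟨h1, h2⟩
    refine ⟨⟨h1, fun l => ?_⟩, h2⟩
    have := h2.1 l
    omega

/-- Chains below `j` are summed by splitting off the first entry; only finitely many of them
contribute. -/
lemma hasSum_nestedSum {b : ℕ} (hb : b ≤ 1) (g : ℕ → ℕ → ℝ) (n : ℕ) (s : Fin n → ℕ) (j : ℕ) :
    HasSum ((chainsBelow b n j).indicator fun m => ∏ i, g (m i) (s i)) (nestedSum b g n s j) := by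
  induction n generalizing j with
  | zero =>
    have : (chainsBelow b 0 j).indicator (fun m => ∏ i, g (m i) (s i)) = fun _ => 1 := by
      ext m
      rw [Set.indicator_of_mem]
      · simp
      · exact ⟨fun i => i.elim0, fun i => i.elim0⟩
    rw [this]
    simp [nestedSum]
  | succ n ih =>
    rw [← (Fin.consEquiv fun _ => ℕ).hasSum_iff]
    have key : ∀ i ∈ range (j + b), HasSum (fun p : ℕ × (Fin n → ℕ) => if p.1 = i then
        g i (s 0) * (chainsBelow b n i).indicator (fun m => ∏ l, g (m l) (Fin.tail s l)) p.2
        else 0) (g i (s 0) * nestedSum b g n (Fin.tail s) i) := by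
      intro i _
      have hinj : Function.Injective (fun m : Fin n → ℕ => (i, m)) := fun x y h => by
        simpa using h
      rw [← hinj.hasSum_iff]
      · simpa [Function.comp_def] using (ih (Fin.tail s) i).mul_left (g i (s 0))
      · rintro ⟨i', m⟩ h
        have : i' ≠ i := by
          rintro rfl
          exact h ⟨m, rfl⟩
        simp [this]
    refine (congrArg (HasSum · _) (funext ?_)).mpr (hasSum_sum key)
    rintro ⟨i, m⟩
    simp only [Function.comp_apply, sum_ite_eq, mem_range]
    change (chainsBelow b (n + 1) j).indicator (fun m => ∏ i, g (m i) (s i))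
      (Fin.cons i m : Fin (n + 1) → ℕ) = _
    classical
    simp only [Set.indicator_apply, cons_mem_chainsBelow hb, Fin.prod_univ_succ, Fin.cons_zero,
      Fin.cons_succ, Fin.tail]
    split_ifs <;> simp_all

lemma hasSum_nestedSum_chain {b : ℕ} (hb : b ≤ 1) (g : ℕ → ℕ → ℝ) (n : ℕ) (s : Fin (n + 1) → ℕ)
    (h : Summable ({m | IsSlackChain b m}.indicator fun m => ∏ i, g (m i) (s i))) :
    HasSum (fun j => g j (s 0) * nestedSum b g n (Fin.tail s) j)
      (∑' m, {m | IsSlackChain b m}.indicator (fun m => ∏ i, g (m i) (s i)) m) := by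
  have h1 := h.hasSum
  rw [← (Fin.consEquiv fun _ => ℕ).hasSum_iff] at h1
  refine h1.prod_fiberwise fun j => ?_
  refine (congrArg (HasSum · _) (funext fun m => ?_)).mpr
    ((hasSum_nestedSum hb g n (Fin.tail s) j).mul_left (g j (s 0)))
  change ({m | IsSlackChain b m} : Set _).indicator (fun m => ∏ i, g (m i) (s i))
      (Fin.cons j m : Fin (n + 1) → ℕ) = _
  classical
  simp only [Set.indicator_apply, Set.mem_ofPred_eq, isSlackChain_cons, Fin.prod_univ_succ,
    Fin.cons_zero, Fin.cons_succ, Fin.tail]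
  split_ifs <;> simp

/-! ### Tuples in an arithmetic progression -/

/-- The tuple of the numbers `a (2 jᵢ + 1)`. -/
def oddMultiples (a : ℕ) {n : ℕ} (m : Fin n → ℕ) : Fin n → ℕ := fun i => a * (2 * m i + 1)

/-- The reciprocals `1 / (a (2 j + 1))` of the elements of the progression. -/
noncomputable def recip (a j : ℕ) : ℝ := 1 / (a * (2 * j + 1))

lemma oddMultiples_injective {a : ℕ} (ha : 1 ≤ a) (n : ℕ) :
    Function.Injective (oddMultiples a : (Fin n → ℕ) → _) := by
  intro x y h
  ext i
  have := congrFun h i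
  simp only [oddMultiples] at this
  have := Nat.eq_of_mul_eq_mul_left ha this
  omega

lemma modEq_iff_exists {a m : ℕ} (ha : 1 ≤ a) :
    0 < m ∧ m ≡ a [MOD 2 * a] ↔ ∃ j, m = a * (2 * j + 1) := by
  constructor
  · rintro ⟨-, h⟩
    have h1 : m % (2 * a) = a := by
      rw [h, Nat.mod_eq_of_lt (by omega)]
    refine ⟨m / (2 * a), ?_⟩
    have := Nat.div_add_mod m (2 * a)
    rw [h1] at this
    linarith
  · rintro ⟨j, rfl⟩
    refine ⟨by positivity, ?_⟩
    have : a * (2 * j + 1) = a + 2 * a * j := by ring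
    rw [this]
    simp [Nat.ModEq]

lemma exists_oddMultiples_eq {a : ℕ} (ha : 1 ≤ a) {n : ℕ} {m : Fin n → ℕ}
    (h : ∀ i, 0 < m i ∧ m i ≡ a [MOD 2 * a]) : ∃ l, oddMultiples a l = m := by
  choose l hl using fun i => (modEq_iff_exists ha).1 (h i)
  exact ⟨l, funext fun i => (hl i).symm⟩

lemma strictTuples_eq {a : ℕ} (ha : 1 ≤ a) (n : ℕ) :
    strictTuples (2 * a) a n = oddMultiples a '' {m | IsSlackChain 0 m} := by
  ext m
  constructor
  · rintro ⟨h1, h2⟩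
    obtain ⟨l, rfl⟩ := exists_oddMultiples_eq ha h2
    refine ⟨l, fun i j hij => ?_, rfl⟩
    have h3 := Nat.lt_of_mul_lt_mul_left (h1 hij)
    omega
  · rintro ⟨l, hl, rfl⟩
    refine ⟨fun i j hij => ?_, fun i => (modEq_iff_exists ha).2 ⟨l i, rfl⟩⟩
    have h3 := hl i j hij
    exact Nat.mul_lt_mul_of_pos_left (by omega) ha

lemma weakTuples_eq {a : ℕ} (ha : 1 ≤ a) (n : ℕ) :
    weakTuples (2 * a) a n = oddMultiples a '' {m | IsSlackChain 1 m} := by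
  ext m
  constructor
  · rintro ⟨h1, h2⟩
    obtain ⟨l, rfl⟩ := exists_oddMultiples_eq ha h2
    refine ⟨l, fun i j hij => ?_, rfl⟩
    have h3 := Nat.le_of_mul_le_mul_left (h1 hij.le) ha
    omega
  · rintro ⟨l, hl, rfl⟩
    refine ⟨fun i j hij => ?_, fun i => (modEq_iff_exists ha).2 ⟨l i, rfl⟩⟩
    rcases hij.eq_or_lt with rfl | hij
    · exact le_rfl
    have h3 := hl i j hij
    exact Nat.mul_le_mul_left a (by omega)

lemma term_oddMultiples (a : ℕ) {n : ℕ} (s m : Fin n → ℕ) :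
    term s (oddMultiples a m) = ∏ i, recip a (m i) ^ s i := by
  simp only [term, oddMultiples, recip, one_div, ← Finset.prod_inv_distrib, inv_pow]
  push_cast
  rfl

lemma summable_image_iff {a : ℕ} (ha : 1 ≤ a) {n : ℕ} (s : Fin n → ℕ) (S : Set (Fin n → ℕ)) :
    Summable (fun m : oddMultiples a '' S => term s m.1) ↔
      Summable (S.indicator fun m => ∏ i, recip a (m i) ^ s i) := by
  rw [← summable_subtype_iff_indicator,
    ← (Equiv.Set.image _ S (oddMultiples_injective ha n)).summable_iff]
  simp [Function.comp_def, term_oddMultiples]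

lemma tsum_image_oddMultiples {a : ℕ} (ha : 1 ≤ a) {n : ℕ} (s : Fin n → ℕ)
    (S : Set (Fin n → ℕ)) :
    ∑' m : oddMultiples a '' S, term s m.1 =
      ∑' m, S.indicator (fun m => ∏ i, recip a (m i) ^ s i) m := by
  rw [← _root_.tsum_subtype, ← (Equiv.Set.image _ S (oddMultiples_injective ha n)).tsum_eq]
  simp [term_oddMultiples]

lemma recip_nonneg (a j : ℕ) : 0 ≤ recip a j := by unfold recip; positivity

lemma recip_le (a j : ℕ) (ha : 1 ≤ a) : recip a j ≤ 1 / ((j : ℝ) + 1) := by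
  unfold recip
  have : (1 : ℝ) ≤ a := by exact_mod_cast ha
  apply one_div_le_one_div_of_le (by positivity)
  nlinarith [(Nat.cast_nonneg j : (0 : ℝ) ≤ j)]

lemma recip_le_one (a j : ℕ) (ha : 1 ≤ a) : recip a j ≤ 1 :=
  (recip_le a j ha).trans (by
    rw [div_le_one (by positivity)]
    linarith [(Nat.cast_nonneg j : (0 : ℝ) ≤ j)])

lemma summable_prod_pi {f : ℕ → ℝ} (hf : Summable f) (h0 : ∀ i, 0 ≤ f i) (n : ℕ) :
    Summable fun m : Fin n → ℕ => ∏ i, f (m i) := by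
  induction n with
  | zero => exact (hasSum_fintype _).summable
  | succ n ih =>
    rw [← (Fin.consEquiv fun _ => ℕ).summable_iff]
    have := hf.mul_of_nonneg ih h0 fun m => prod_nonneg fun i _ => h0 _
    refine this.congr fun p => ?_
    simp [Fin.prod_univ_succ]

/-- For an admissible index the terms are summable over all weakly decreasing tuples: the surplus
in the first exponent can be distributed over the other variables, since the first variable is the
largest, and the resulting product has all exponents larger than one. -/
lemma summable_indicator {a : ℕ} (ha : 1 ≤ a) {b : ℕ} (hb : b ≤ 1) {n : ℕ} (s : Fin n → ℕ)
    (hs : IsAdmissible s) :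
    Summable ({m | IsSlackChain b m}.indicator fun m => ∏ i, recip a (m i) ^ s i) := by
  cases n with
  | zero => exact (hasSum_fintype _).summable
  | succ n =>
    set e : ℝ := 1 / (n + 1) with he
    have he0 : 0 < e := by positivity
    have hsum : Summable fun j : ℕ => (1 / ((j : ℝ) + 1)) ^ (1 + e) := by
      have := (summable_nat_add_iff 1).2
        (Real.summable_one_div_nat_rpow (p := 1 + e) |>.2 (by linarith))
      refine this.congr fun j => ?_
      rw [Real.div_rpow (by norm_num) (by positivity)]
      simp
    refine Summable.of_nonneg_of_le (fun m => ?_) (fun m => ?_)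
      (summable_prod_pi hsum (fun i => by positivity) (n + 1))
    · exact Set.indicator_nonneg
        (fun m _ => prod_nonneg fun i _ => pow_nonneg (recip_nonneg _ _) _) _
    by_cases hm : m ∈ {m : Fin (n + 1) → ℕ | IsSlackChain b m}
    swap
    · rw [Set.indicator_of_notMem hm]
      exact prod_nonneg fun i _ => by positivity
    rw [Set.indicator_of_mem hm]
    set y : ℕ → ℝ := fun j => 1 / ((j : ℝ) + 1) with hy
    have hy0 : ∀ j, 0 < y j := fun j => by simp only [hy]; positivity
    have h1 : ∀ i, recip a (m i) ^ s i ≤ y (m i) ^ (s i) := fun i =>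
      pow_le_pow_left₀ (recip_nonneg _ _) (recip_le _ _ ha) _
    have hy1 : ∀ j, y j ≤ 1 := fun j => by
      simp only [hy]
      rw [div_le_one (by positivity)]
      linarith [(Nat.cast_nonneg j : (0 : ℝ) ≤ j)]
    have hle : ∀ i, y (m 0) ≤ y (m i) := by
      intro i
      rcases eq_or_ne i 0 with rfl | hi
      · exact le_rfl
      have := hm 0 i (Fin.pos_of_ne_zero hi)
      have h2 : (m i : ℝ) ≤ m 0 := by exact_mod_cast (by omega : m i ≤ m 0)
      exact one_div_le_one_div_of_le (by positivity) (by linarith)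
    have h2 : ∏ i, recip a (m i) ^ s i ≤ y (m 0) * ∏ i, y (m i) := by
      rw [Fin.prod_univ_succ, Fin.prod_univ_succ, ← mul_assoc]
      refine mul_le_mul ?_ (prod_le_prod (fun i _ => pow_nonneg (recip_nonneg _ _) _)
        fun i _ => ?_) (prod_nonneg fun i _ => pow_nonneg (recip_nonneg _ _) _)
        (mul_nonneg (hy0 _).le (hy0 _).le)
      · refine (h1 0).trans ?_
        rw [← pow_two]
        exact pow_le_pow_of_le_one (hy0 _).le (hy1 _) (hs.2 0 rfl)
      · refine (h1 _).trans ?_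
        simpa using pow_le_pow_of_le_one (hy0 (m i.succ)).le (hy1 _) (hs.1 i.succ)
    refine h2.trans ?_
    have h3 : y (m 0) ≤ ∏ i, y (m i) ^ e := by
      calc y (m 0) = ∏ _i : Fin (n + 1), y (m 0) ^ e := by
            rw [prod_const, card_univ, Fintype.card_fin, ← Real.rpow_natCast, ← Real.rpow_mul
              (hy0 _).le]
            have : e * ((n + 1 : ℕ) : ℝ) = 1 := by
              rw [he]; push_cast; field_simp
            rw [this, Real.rpow_one]
        _ ≤ _ := prod_le_prod (fun i _ => Real.rpow_nonneg (hy0 _).le _) fun i _ =>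
            Real.rpow_le_rpow (hy0 _).le (hle i) he0.le
    calc y (m 0) * ∏ i, y (m i) ≤ (∏ i, y (m i) ^ e) * ∏ i, y (m i) :=
          mul_le_mul_of_nonneg_right h3 (prod_nonneg fun i _ => (hy0 _).le)
      _ = _ := by
          rw [← prod_mul_distrib]
          refine prod_congr rfl fun i _ => ?_
          rw [add_comm 1 e, Real.rpow_add (hy0 _), Real.rpow_one]

/-! ### Generating series of nested sums -/

/-- The geometric series `∑ xⁿ Xⁿ = 1 / (1 - x X)`. -/
noncomputable def geom (x : ℝ) : PowerSeries ℝ := mk fun n => x ^ n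

/-- The series `x X / (1 - x X)`, the geometric series without its constant term. -/
noncomputable def geomTail (x : ℝ) : PowerSeries ℝ := mk fun k => if 1 ≤ k then x ^ k else 0

/-- The series `(1 + x X) / (1 - x X)`. -/
noncomputable def cayley (x : ℝ) : PowerSeries ℝ := 1 + 2 * geomTail x

/-- The iterated sum `∑ A i₁ ⋯ A iₙ` over the chains with slack `b` below `j`. -/
noncomputable def nestedSeries (b : ℕ) (A : ℕ → PowerSeries ℝ) : ℕ → ℕ → PowerSeries ℝ
  | 0, _ => 1
  | n + 1, j => ∑ i ∈ range (j + b), A i * nestedSeries b A n i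

lemma geom_mul (x : ℝ) : geom x * (1 - C x * X) = 1 := by
  ext n
  rw [mul_sub, mul_one, ← mul_assoc, map_sub]
  cases n with
  | zero => simp [geom]
  | succ n => simp [geom, coeff_succ_mul_X, pow_succ, coeff_one]

lemma geomTail_eq (x : ℝ) : geomTail x = geom x - 1 := by
  ext n
  cases n <;> simp [geom, geomTail, coeff_one]

lemma cayley_eq (x : ℝ) : cayley x = (1 + C x * X) * geom x := by
  rw [cayley, geomTail_eq]
  linear_combination geom_mul x

lemma geom_neg_mul_cayley (x : ℝ) : geom (-x) * cayley x = geom x := by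
  rw [cayley_eq]
  have := geom_mul (-x)
  rw [map_neg] at this
  linear_combination geom x * this

lemma cayley_neg_mul (x : ℝ) : cayley (-x) * cayley x = 1 := by
  rw [cayley_eq (-x), mul_assoc, geom_neg_mul_cayley, map_neg]
  linear_combination geom_mul x

lemma rescale_geom (x : ℝ) : rescale (-1 : ℝ) (geom x) = geom (-x) := by
  ext n
  simp [geom, ← mul_pow]

lemma rescale_cayley (x : ℝ) : rescale (-1 : ℝ) (cayley x) = cayley (-x) := by
  simp only [cayley, geomTail_eq, map_add, map_mul, map_sub, map_one, rescale_geom, map_ofNat]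

lemma X_dvd_geomTail (x : ℝ) : X ∣ geomTail x := by
  rw [X_dvd_iff]
  simp [geomTail, ← coeff_zero_eq_constantCoeff_apply]

lemma sum_antidiagonalTuple_succ (n d : ℕ) (f : (Fin (n + 1) → ℕ) → ℝ) :
    ∑ s ∈ Nat.antidiagonalTuple (n + 1) d, f s =
      ∑ p ∈ antidiagonal d, ∑ s ∈ Nat.antidiagonalTuple n p.2, f (Fin.cons p.1 s) := by
  rw [Finset.sum_sigma']
  refine sum_bij' (fun s _ => ⟨(s 0, ∑ i, Fin.tail s i), Fin.tail s⟩)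
    (fun p _ => Fin.cons p.1.1 p.2) ?_ ?_ ?_ ?_ ?_
  · intro s hs
    rw [Nat.mem_antidiagonalTuple, Fin.sum_univ_succ] at hs
    simpa [Nat.mem_antidiagonalTuple, Fin.tail] using hs
  · rintro ⟨⟨p, q⟩, s⟩ h
    simp only [mem_sigma, HasAntidiagonal.mem_antidiagonal, Nat.mem_antidiagonalTuple] at h
    simp [Nat.mem_antidiagonalTuple, Fin.sum_univ_succ, h.2, h.1]
  · intro s _
    simp
  · rintro ⟨⟨p, q⟩, s⟩ h
    simp only [mem_sigma, HasAntidiagonal.mem_antidiagonal, Nat.mem_antidiagonalTuple] at h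
    simp [h.2]
  · intro s _
    simp

/-- The coefficients of `nestedSeries` collect the nested sums over all indices of a given weight,
the exponent of each variable being weighted by the coefficients of `A i`. -/
lemma coeff_nestedSeries (b : ℕ) (A : ℕ → PowerSeries ℝ) (n d j : ℕ) :
    coeff d (nestedSeries b A n j) =
      ∑ s ∈ Nat.antidiagonalTuple n d, nestedSum b (fun i k => coeff k (A i)) n s j := by
  induction n generalizing d j with
  | zero =>
    cases d with
    | zero => simp [nestedSeries, nestedSum]
    | succ d => simp [nestedSeries, coeff_one]
  | succ n ih =>
    rw [sum_antidiagonalTuple_succ]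
    simp only [nestedSeries, nestedSum, map_sum, coeff_mul, ih, mul_sum, Fin.cons_zero,
      Fin.tail_cons]
    rw [sum_comm]
    exact sum_congr rfl fun p _ => sum_comm

lemma nestedSum_ite (b : ℕ) (x : ℕ → ℝ) (n : ℕ) (s : Fin n → ℕ) (j : ℕ) :
    nestedSum b (fun i k => if 1 ≤ k then x i ^ k else 0) n s j =
      if ∀ i, 1 ≤ s i then nestedSum b (fun i k => x i ^ k) n s j else 0 := by
  induction n generalizing j with
  | zero => simp [nestedSum]
  | succ n ih =>
    simp only [nestedSum, ih, Fin.forall_fin_succ, Fin.tail]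
    by_cases h0 : 1 ≤ s 0 <;> by_cases h1 : ∀ i : Fin n, 1 ≤ s i.succ <;> simp [h0, h1]

/-- Divided by `X ^ N`, the truncated depth generating series `∑_{n < N} cⁿ Wₙ` has the same
remainder as any solution `Q` of the recursion `Q j = 1 + c ∑ A i Q i`. -/
lemma X_pow_dvd_sum_nestedSeries {b : ℕ} {A : ℕ → PowerSeries ℝ} (hA : ∀ i, X ∣ A i)
    (c : PowerSeries ℝ) {Q : ℕ → PowerSeries ℝ}
    (hQ : ∀ j, Q j = 1 + c * ∑ i ∈ range (j + b), A i * Q i) (N j : ℕ) :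
    X ^ N ∣ (∑ n ∈ range N, c ^ n * nestedSeries b A n j) - Q j := by
  induction N generalizing j with
  | zero => simp
  | succ N ih =>
    have : (∑ n ∈ range (N + 1), c ^ n * nestedSeries b A n j) - Q j =
        c * ∑ i ∈ range (j + b),
          A i * ((∑ n ∈ range N, c ^ n * nestedSeries b A n i) - Q i) := by
      rw [sum_range_succ', hQ j]
      simp only [nestedSeries, pow_zero, one_mul, mul_sub, sum_sub_distrib, mul_sum]
      rw [sum_comm]
      have h : ∑ i ∈ range (j + b), ∑ n ∈ range N, c ^ (n + 1) * (A i * nestedSeries b A n i) =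
          ∑ i ∈ range (j + b), ∑ n ∈ range N, c * (A i * (c ^ n * nestedSeries b A n i)) :=
        sum_congr rfl fun i _ => sum_congr rfl fun n _ => by ring
      rw [h]
      ring
    rw [this]
    refine Dvd.dvd.mul_left (dvd_sum fun i _ => ?_) c
    rw [pow_succ']
    exact mul_dvd_mul (hA i) (ih i)

/-- The sum over the admissible indices of weight `k` and depth `n` of the sums over the chains
with slack `b`. -/
noncomputable def chainValueSum (b a k n : ℕ) : ℝ :=
  ∑ s ∈ admissibleIndices k n,
    ∑' m, {m | IsSlackChain b m}.indicator (fun m => ∏ i, recip a (m i) ^ s i) m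

lemma G_eq {a : ℕ} (ha : 1 ≤ a) (k n : ℕ) : G (2 * a) a k n = chainValueSum 0 a k n := by
  refine sum_congr rfl fun s _ => ?_
  rw [tValue, strictTuples_eq ha, tsum_image_oddMultiples ha]

lemma GStar_eq {a : ℕ} (ha : 1 ≤ a) (k n : ℕ) :
    GStar (2 * a) a k n = chainValueSum 1 a k n := by
  refine sum_congr rfl fun s _ => ?_
  rw [tStarValue, weakTuples_eq ha, tsum_image_oddMultiples ha]

lemma isAdmissible_succ_iff {n : ℕ} (s : Fin (n + 1) → ℕ) :
    IsAdmissible s ↔ 2 ≤ s 0 ∧ ∀ i, 1 ≤ Fin.tail s i := by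
  constructor
  · rintro ⟨h1, h2⟩
    exact ⟨h2 0 rfl, fun i => h1 i.succ⟩
  · rintro ⟨h1, h2⟩
    refine ⟨fun i => ?_, fun i hi => ?_⟩
    · induction i using Fin.cases with
      | zero => omega
      | succ i => exact h2 i
    · rwa [Fin.ext (a := i) (b := 0) hi]

lemma hasSum_chainValueSum {a b : ℕ} (ha : 1 ≤ a) (hb : b ≤ 1) (k n : ℕ) :
    HasSum (fun j => coeff k (X ^ 2 * (C (recip a j ^ 2) * geom (recip a j)) *
      nestedSeries b (fun i => geomTail (recip a i)) n j)) (chainValueSum b a k (n + 1)) := by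
  have h := hasSum_sum fun s (hs : s ∈ admissibleIndices k (n + 1)) =>
    hasSum_nestedSum_chain hb (fun i k => recip a i ^ k) n s
      (summable_indicator ha hb s (mem_filter.1 hs).2)
  refine (congrArg (HasSum · _) (funext fun j => ?_)).mpr h
  have hB : ∀ l, coeff l (X ^ 2 * (C (recip a j ^ 2) * geom (recip a j))) =
      if 2 ≤ l then recip a j ^ l else 0 := by
    intro l
    rw [coeff_X_pow_mul']
    split_ifs with hl
    · rw [coeff_C_mul, geom, coeff_mk, ← pow_add, Nat.add_sub_cancel' hl]
    · rfl
  rw [coeff_mul, admissibleIndices, sum_filter, sum_antidiagonalTuple_succ]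
  refine sum_congr rfl fun p _ => ?_
  rw [hB, coeff_nestedSeries, mul_sum]
  refine sum_congr rfl fun s _ => ?_
  simp only [geomTail, coeff_mk, nestedSum_ite, isAdmissible_succ_iff, Fin.cons_zero,
    Fin.tail_cons]
  by_cases h0 : 2 ≤ p.1 <;> by_cases h1 : ∀ i : Fin n, 1 ≤ s i <;> simp [h0, h1]

lemma hasSum_weighted {a b : ℕ} (ha : 1 ≤ a) (hb : b ≤ 1) (c : ℝ) {Q : ℕ → PowerSeries ℝ}
    (hQ : ∀ j, Q j = 1 + C c * ∑ i ∈ range (j + b), geomTail (recip a i) * Q i) (d : ℕ) :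
    HasSum (fun j => coeff d (C (recip a j ^ 2) * geom (recip a j) * Q j))
      (∑ n ∈ range (d + 1), c ^ n * chainValueSum b a (d + 2) (n + 1)) := by
  have h := hasSum_sum fun n (_ : n ∈ range (d + 1)) =>
    (hasSum_chainValueSum ha hb (d + 2) n).mul_left (c ^ n)
  refine (congrArg (HasSum · _) (funext fun j => ?_)).mpr h
  have h1 := X_pow_dvd_sum_nestedSeries (fun i => X_dvd_geomTail (recip a i)) (C c) hQ (d + 1) j
  have h2 := X_pow_dvd_iff.1
    (h1.mul_left (C (recip a j ^ 2) * geom (recip a j))) d (Nat.lt_succ_self d)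
  rw [mul_sub, map_sub, sub_eq_zero] at h2
  rw [← h2, mul_sum, map_sum]
  refine sum_congr rfl fun n _ => ?_
  rw [mul_assoc (X ^ 2), add_comm d 2, add_comm 2 d, coeff_X_pow_mul, ← coeff_C_mul, map_pow C c n]
  congr 1
  ring

lemma sum_Icc_eq_sum_range (d : ℕ) (f : ℕ → ℝ) :
    ∑ n ∈ Icc 1 (d + 2 - 1), f n = ∑ n ∈ range (d + 1), f (n + 1) := by
  rw [range_eq_Ico, sum_Ico_add' f 0 (d + 1) 1]
  rfl

/-- The generating series of the strict weighted sums, restricted to largest index `j`. -/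
noncomputable def layer (a j : ℕ) : PowerSeries ℝ :=
  C (recip a j ^ 2) * geom (recip a j) * ∏ i ∈ range j, cayley (recip a i)

lemma hasSum_weightedSum {a : ℕ} (ha : 1 ≤ a) (d : ℕ) :
    HasSum (fun j => coeff d (layer a j)) (weightedSum a (d + 2)) := by
  have hQ : ∀ j, ∏ i ∈ range j, cayley (recip a i) = 1 + C 2 * ∑ i ∈ range (j + 0),
      geomTail (recip a i) * ∏ l ∈ range i, cayley (recip a l) := by
    intro j
    induction j with
    | zero => simp
    | succ j ih =>
      rw [prod_range_succ, add_zero, sum_range_succ, mul_add, ← add_assoc, ← add_zero j, ← ih,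
        add_zero, cayley, map_ofNat]
      ring
  rw [weightedSum, sum_Icc_eq_sum_range]
  simpa [G_eq ha, layer] using hasSum_weighted ha zero_le_one 2 hQ d

/-- Up to the sign `(-1)^d`, the starred sums have the generating series
`x² / (1 - x X) · ∏_{i ≤ j} (1 - xᵢ X) / (1 + xᵢ X)`. The substitution `X ↦ -X` turns it into the
series of the unstarred sums. -/
lemma hasSum_weightedStarSum {a : ℕ} (ha : 1 ≤ a) (d : ℕ) :
    HasSum (fun j => coeff d (layer a j)) (weightedStarSum a (d + 2)) := by
  have hQ : ∀ j, ∏ i ∈ range j, cayley (-recip a i) = 1 + C (-2) * ∑ i ∈ range j,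
      geomTail (recip a i) * ∏ l ∈ range (i + 1), cayley (-recip a l) := by
    intro j
    induction j with
    | zero => simp
    | succ j ih =>
      rw [sum_range_succ, mul_add, ← add_assoc, ← ih, prod_range_succ]
      have := cayley_neg_mul (recip a j)
      rw [cayley.eq_1 (recip a j)] at this
      simp only [map_neg, map_ofNat]
      linear_combination (∏ i ∈ range j, cayley (-recip a i)) * this
  have h := (hasSum_weighted ha le_rfl (-2) (fun j => hQ (j + 1)) d).mul_left ((-1) ^ d)
  have hsum : weightedStarSum a (d + 2) = (-1) ^ d *
      ∑ n ∈ range (d + 1), (-2) ^ n * chainValueSum 1 a (d + 2) (n + 1) := by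
    rw [weightedStarSum, sum_Icc_eq_sum_range, mul_sum]
    refine sum_congr rfl fun n hn => ?_
    obtain ⟨e, rfl⟩ := Nat.exists_eq_add_of_le (Nat.lt_succ_iff.1 (mem_range.1 hn))
    have h1 : n + e + 2 - (n + 1) - 1 = e := by omega
    have h2 : (-1 : ℝ) ^ n * (-1) ^ n = 1 := by rw [← mul_pow]; simp
    rw [GStar_eq ha, h1, Nat.add_sub_cancel, pow_add, neg_pow (2 : ℝ)]
    linear_combination -(-1) ^ e * 2 ^ n * chainValueSum 1 a (n + e + 2) (n + 1) * h2
  rw [hsum]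
  refine (congrArg (HasSum · _) (funext fun j => ?_)).mpr h
  rw [← coeff_rescale]
  congr 1
  have hC : rescale (-1 : ℝ) (C (recip a j ^ 2)) = C (recip a j ^ 2) := by
    ext n
    rw [coeff_rescale, coeff_C]
    split_ifs with h <;> simp [h]
  simp only [map_mul, map_prod, rescale_geom, rescale_cayley, neg_neg, prod_range_succ]
  rw [hC, layer, ← geom_neg_mul_cayley]
  ring

lemma t_eq_tsum (n : ℕ) : t n = ∑' j, recip 1 j ^ n := by
  have h : strictTuples 2 1 1 = oddMultiples 1 '' {m | IsSlackChain 0 m} :=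
    strictTuples_eq le_rfl 1
  rw [t, tValue, h, tsum_image_oddMultiples le_rfl,
    ← (Equiv.funUnique (Fin 1) ℕ).symm.tsum_eq]
  refine tsum_congr fun j => ?_
  rw [Set.indicator_of_mem]
  · simp
  · intro p q hpq
    exact absurd hpq (by simp [Subsingleton.elim p q])

/-! ### Evaluation of power series with nonnegative coefficients -/

/-- The power series `φ` has nonnegative coefficients and converges to `x` at the point `u`. -/
def EvalsTo (φ : PowerSeries ℝ) (u x : ℝ) : Prop :=
  (∀ n, 0 ≤ coeff n φ) ∧ HasSum (fun n => coeff n φ * u ^ n) x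

/-- Interchange of summation for a nonnegative double series. -/
lemma hasSum_swap {g : ℕ → ℕ → ℝ} (hg : ∀ i j, 0 ≤ g i j) {r c : ℕ → ℝ} {x : ℝ}
    (hr : ∀ i, HasSum (g i) (r i)) (hx : HasSum r x) (hc : ∀ j, HasSum (fun i => g i j) (c j)) :
    HasSum c x := by
  have h1 : Summable (Function.uncurry g) := by
    rw [summable_prod_of_nonneg (f := Function.uncurry g) fun p => hg p.1 p.2]
    refine ⟨fun i => (hr i).summable, ?_⟩
    refine hx.summable.congr fun i => ?_
    exact (hr i).tsum_eq.symm
  have h2 : HasSum (Function.uncurry g) x := by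
    have h3 := h1.hasSum.prod_fiberwise hr
    rw [hx.unique h3]
    exact h1.hasSum
  rw [← (Equiv.prodComm ℕ ℕ).hasSum_iff] at h2
  exact h2.prod_fiberwise hc

namespace EvalsTo

variable {φ ψ : PowerSeries ℝ} {u x y : ℝ}

lemma const {c : ℝ} (hc : 0 ≤ c) (u : ℝ) : EvalsTo (C c) u c := by
  refine ⟨fun n => ?_, ?_⟩
  · rw [coeff_C]
    split_ifs <;> simp [hc]
  · have h := hasSum_single (f := fun n => coeff n (C c) * u ^ n) 0 fun n hn => by
      simp [coeff_C, hn]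
    simpa using h

lemma const_mul_X {c : ℝ} (hc : 0 ≤ c) (u : ℝ) : EvalsTo (C c * X) u (c * u) := by
  refine ⟨fun n => ?_, ?_⟩
  · rw [coeff_C_mul, coeff_X]
    split_ifs <;> simp [hc]
  · have h := hasSum_single (f := fun n => coeff n (C c * X) * u ^ n) 1 fun n hn => by
      simp [coeff_C_mul, coeff_X, hn]
    simpa [coeff_C_mul, coeff_X] using h

lemma add (hφ : EvalsTo φ u x) (hψ : EvalsTo ψ u y) : EvalsTo (φ + ψ) u (x + y) := by
  refine ⟨fun n => ?_, ?_⟩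
  · rw [map_add]
    exact add_nonneg (hφ.1 n) (hψ.1 n)
  · simpa [add_mul] using hφ.2.add hψ.2

lemma mul (hφ : EvalsTo φ u x) (hψ : EvalsTo ψ u y) :
    EvalsTo (φ * ψ) u (x * y) := by
  refine ⟨fun n => ?_, ?_⟩
  · rw [coeff_mul]
    exact sum_nonneg fun p _ => mul_nonneg (hφ.1 _) (hψ.1 _)
  · have h1 : Summable fun n => ‖coeff n φ * u ^ n‖ := hφ.2.summable.norm
    have h2 : Summable fun n => ‖coeff n ψ * u ^ n‖ := hψ.2.summable.norm
    have h3 := (summable_norm_sum_mul_antidiagonal_of_summable_norm h1 h2).of_norm.hasSum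
    rw [← tsum_mul_tsum_eq_tsum_sum_antidiagonal_of_summable_norm h1 h2, hφ.2.tsum_eq,
      hψ.2.tsum_eq] at h3
    refine (congrArg (HasSum · _) (funext fun n => ?_)).mpr h3
    rw [coeff_mul, sum_mul]
    refine sum_congr rfl fun p hp => ?_
    rw [← HasAntidiagonal.mem_antidiagonal.1 hp, pow_add]
    ring

lemma prod {f : ℕ → PowerSeries ℝ} {z : ℕ → ℝ} (h : ∀ i, EvalsTo (f i) u (z i))
    (n : ℕ) : EvalsTo (∏ i ∈ range n, f i) u (∏ i ∈ range n, z i) := by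
  induction n with
  | zero => simpa using const zero_le_one u
  | succ n ih =>
    rw [prod_range_succ, prod_range_succ]
    exact ih.mul (h n)

lemma pow (hφ : EvalsTo φ u x) (n : ℕ) : EvalsTo (φ ^ n) u (x ^ n) := by
  simpa using prod (fun _ => hφ) n

end EvalsTo

lemma coeff_pow_eq_zero {φ : PowerSeries ℝ} (h0 : constantCoeff φ = 0) {n m : ℕ} (h : n < m) :
    coeff n (φ ^ m) = 0 :=
  X_pow_dvd_iff.1 (pow_dvd_pow_of_dvd (X_dvd_iff.2 h0) m) n h

lemma coeff_formalExp {φ : PowerSeries ℝ} (h0 : constantCoeff φ = 0) {n N : ℕ} (h : n < N) :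
    coeff n (formalExp φ) = ∑ m ∈ range N, 1 / (m.factorial : ℝ) * coeff n (φ ^ m) := by
  rw [formalExp, coeff_subst' (HasSubst.of_constantCoeff_zero' h0),
    finsum_eq_sum_of_support_subset (s := range N)]
  · refine sum_congr rfl fun m _ => ?_
    simp [coeff_exp]
  · intro m hm
    by_contra hmN
    refine hm ?_
    change coeff m (exp ℝ) • coeff n (φ ^ m) = 0
    rw [coeff_pow_eq_zero h0, smul_zero]
    simp at hmN
    omega

lemma EvalsTo.formalExp {φ : PowerSeries ℝ} {u x : ℝ} (hu : 0 ≤ u) (hφ : EvalsTo φ u x)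
    (h0 : constantCoeff φ = 0) : EvalsTo (formalExp φ) u (Real.exp x) := by
  refine ⟨fun n => ?_, ?_⟩
  · rw [coeff_formalExp h0 (Nat.lt_succ_self n)]
    exact sum_nonneg fun m _ => mul_nonneg (by positivity) ((hφ.pow m).1 n)
  · refine hasSum_swap (g := fun m n => 1 / (m.factorial : ℝ) * (coeff n (φ ^ m) * u ^ n))
      (r := fun m => 1 / (m.factorial : ℝ) * x ^ m) (fun m n => ?_)
      (fun m => (hφ.pow m).2.mul_left _) ?_ (fun n => ?_)
    · exact mul_nonneg (by positivity) (mul_nonneg ((hφ.pow m).1 n) (by positivity))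
    · rw [Real.exp_eq_exp_ℝ]
      simpa [div_eq_inv_mul] using NormedSpace.exp_series_hasSum_exp' (𝕂 := ℝ) x
    · rw [coeff_formalExp h0 (Nat.lt_succ_self n), sum_mul]
      simp only [← mul_assoc]
      refine hasSum_sum_of_ne_finset_zero fun m hm => ?_
      rw [coeff_pow_eq_zero h0]
      · simp
      · simpa using hm

/-- Two power series which converge to the same values on an interval `[0, r]` coincide. -/
lemma eq_of_hasSum_eq {φ ψ : PowerSeries ℝ} {f : ℝ → ℝ} {r : ℝ} (hr : 0 < r)
    (hφ : ∀ u, 0 ≤ u → u ≤ r → HasSum (fun n => coeff n φ * u ^ n) (f u))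
    (hψ : ∀ u, 0 ≤ u → u ≤ r → HasSum (fun n => coeff n ψ * u ^ n) (f u)) : φ = ψ := by
  rw [← sub_eq_zero]
  set e := φ - ψ with he
  have hz : ∀ u, 0 ≤ u → u ≤ r → HasSum (fun n => coeff n e * u ^ n) 0 := by
    intro u h0 h1
    simpa [he, sub_mul] using (hφ u h0 h1).sub (hψ u h0 h1)
  ext n
  rw [map_zero]
  induction n using Nat.strong_induction_on with
  | _ n ih =>
  -- The tail after the `n`-th coefficient is bounded by a multiple of `u`.
  have hS : Summable fun i => |coeff (i + (n + 1)) e| * r ^ i := by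
    have h1 := ((summable_nat_add_iff (n + 1)).2 (hz r hr.le le_rfl).summable).norm
    refine (h1.mul_right ((r ^ (n + 1))⁻¹)).congr fun i => ?_
    rw [norm_mul, Real.norm_eq_abs, Real.norm_of_nonneg (by positivity), pow_add]
    field_simp
  set M := ∑' i, |coeff (i + (n + 1)) e| * r ^ i
  have hM : ∀ u, 0 < u → u ≤ r → |coeff n e| ≤ M * u := by
    intro u h0 h1
    have h2 := (hasSum_nat_add_iff' (n + 1)).2 (hz u h0.le h1)
    rw [sum_range_succ, sum_eq_zero fun i hi => by rw [ih i (mem_range.1 hi), zero_mul]] at h2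
    have h3 : HasSum (fun i => |coeff (i + (n + 1)) e| * r ^ i * u ^ (n + 1))
      (M * u ^ (n + 1)) := hS.hasSum.mul_right _
    have h4 : |0 - (0 + coeff n e * u ^ n)| ≤ M * u ^ (n + 1) := by
      rw [← h2.tsum_eq, ← h3.tsum_eq, ← Real.norm_eq_abs]
      refine tsum_of_norm_bounded h3.summable.hasSum fun i => ?_
      rw [norm_mul, Real.norm_eq_abs, Real.norm_of_nonneg (by positivity), pow_add, mul_assoc]
      gcongr
    rw [zero_sub, zero_add, abs_neg, abs_mul, abs_of_pos (by positivity : 0 < u ^ n), pow_succ',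
      ← mul_assoc] at h4
    exact le_of_mul_le_mul_right h4 (by positivity)
  by_contra hne
  have hpos : 0 < |coeff n e| := abs_pos.2 hne
  have hM0 : 0 ≤ M := tsum_nonneg fun i => by positivity
  have h5 := hM (min r (|coeff n e| / (2 * (M + 1)))) (by positivity) (min_le_left _ _)
  have h6 : M * min r (|coeff n e| / (2 * (M + 1))) ≤
      (M + 1) * (|coeff n e| / (2 * (M + 1))) :=
    mul_le_mul (by linarith) (min_le_right _ _) (by positivity) (by positivity)
  have h7 : (M + 1) * (|coeff n e| / (2 * (M + 1))) = |coeff n e| / 2 := by field_simp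
  linarith

lemma evalsTo_geom {x u : ℝ} (hx : 0 ≤ x) (hu : 0 ≤ u) (h : x * u < 1) :
    EvalsTo (geom x) u (1 - x * u)⁻¹ := by
  refine ⟨fun n => ?_, ?_⟩
  · rw [geom, coeff_mk]
    positivity
  · simpa [geom, mul_pow] using hasSum_geometric_of_lt_one (mul_nonneg hx hu) h

lemma evalsTo_cayley {x u : ℝ} (hx : 0 ≤ x) (hu : 0 ≤ u) (h : x * u < 1) :
    EvalsTo (cayley x) u ((1 + x * u) / (1 - x * u)) := by
  rw [cayley_eq, div_eq_mul_inv]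
  refine EvalsTo.mul ?_ (evalsTo_geom hx hu h)
  simpa using (EvalsTo.const zero_le_one u).add (EvalsTo.const_mul_X hx u)

/-! ### The hypergeometric sum -/

/-- The product `∏_{i < j} (2 i + 1 + v) / (2 i + 1 - v)`. -/
noncomputable def cayleyProd (v : ℝ) (j : ℕ) : ℝ :=
  ∏ i ∈ range j, (2 * (i : ℝ) + 1 + v) / (2 * i + 1 - v)

/-- The terms of the hypergeometric series `hyperSum`. -/
noncomputable def hyperTerm (v : ℝ) (j : ℕ) : ℝ :=
  cayleyProd v j / ((2 * j + 1) * (2 * j + 1 - v))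

/-- The hypergeometric sum `∑ⱼ cayleyProd v j / ((2 j + 1) (2 j + 1 - v))`, an instance of the
well-poised series `₃F₂` at `1`. -/
noncomputable def hyperSum (v : ℝ) : ℝ := ∑' j, hyperTerm v j

lemma odd_sub_pos {v : ℝ} (hv : v ≤ 1 / 8) (j : ℕ) : 0 < 2 * (j : ℝ) + 1 - v := by
  have : (0 : ℝ) ≤ j := j.cast_nonneg
  linarith

lemma cayleyProd_zero (v : ℝ) : cayleyProd v 0 = 1 := by simp [cayleyProd]

lemma cayleyProd_succ (v : ℝ) (j : ℕ) :
    cayleyProd v (j + 1) = cayleyProd v j * ((2 * (j : ℝ) + 1 + v) / (2 * j + 1 - v)) := by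
  rw [cayleyProd, prod_range_succ, cayleyProd]

/-- The product grows like `j ^ v`. The crude bound `√(j + 1)` suffices for all limits below and
needs only `v ≤ 1 / 8`. -/
lemma cayleyProd_sq_le {v : ℝ} (hv : v ≤ 1 / 8) (j : ℕ) : cayleyProd v j ^ 2 ≤ j + 1 := by
  induction j with
  | zero => simp [cayleyProd_zero]
  | succ j ih =>
    have hd := odd_sub_pos hv j
    have hj : (0 : ℝ) ≤ j := j.cast_nonneg
    rw [cayleyProd_succ, mul_pow, div_pow, ← mul_div_assoc, div_le_iff₀ (by positivity)]
    have h1 := mul_le_mul_of_nonneg_right ih (sq_nonneg (2 * (j : ℝ) + 1 + v))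
    refine h1.trans ?_
    push_cast
    rcases le_or_gt v 0 with h0 | h0
    · nlinarith [mul_nonneg hj (neg_nonneg.2 h0), mul_nonneg (mul_nonneg hj hj) (neg_nonneg.2 h0),
        sq_nonneg (2 * (j : ℝ) + 1 - v)]
    · nlinarith [mul_nonneg hj h0.le, mul_nonneg (mul_nonneg hj hj) (sub_nonneg.2 hv),
        mul_nonneg hj (sub_nonneg.2 hv), sq_nonneg v]

lemma cayleyProd_sq_le_one {v : ℝ} (hv : v ≤ 0) (j : ℕ) : cayleyProd v j ^ 2 ≤ 1 := by
  induction j with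
  | zero => simp [cayleyProd_zero]
  | succ j ih =>
    have hd := odd_sub_pos (v := v) (by linarith) j
    have hj : (0 : ℝ) ≤ j := j.cast_nonneg
    rw [cayleyProd_succ, mul_pow, div_pow, ← mul_div_assoc, div_le_iff₀ (by positivity)]
    have h1 := mul_le_mul_of_nonneg_right ih (sq_nonneg (2 * (j : ℝ) + 1 + v))
    refine h1.trans ?_
    nlinarith [mul_nonneg hj (neg_nonneg.2 hv)]

lemma abs_cayleyProd_le {v : ℝ} (hv : v ≤ 1 / 8) (j : ℕ) :
    |cayleyProd v j| ≤ √((j : ℝ) + 1) :=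
  Real.abs_le_sqrt (cayleyProd_sq_le hv j)

lemma odd_sub_ge {v : ℝ} (hv : v ≤ 1 / 8) (j : ℕ) : ((j : ℝ) + 1) / 2 ≤ 2 * (j : ℝ) + 1 - v := by
  have : (0 : ℝ) ≤ j := j.cast_nonneg
  linarith

lemma summable_hyperTerm {v : ℝ} (hv : v ≤ 1 / 8) : Summable (hyperTerm v) := by
  have hsum : Summable fun j : ℕ => 2 * (1 / ((j : ℝ) + 1) ^ (3 / 2 : ℝ)) := by
    have := (summable_nat_add_iff 1).2
      (Real.summable_one_div_nat_rpow (p := 3 / 2) |>.2 (by norm_num))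
    refine (this.mul_left 2).congr fun j => ?_
    simp
  refine Summable.of_norm_bounded hsum fun j => ?_
  have hj : (0 : ℝ) < (j : ℝ) + 1 := by positivity
  have hd := odd_sub_pos hv j
  rw [hyperTerm, norm_div, Real.norm_eq_abs, Real.norm_of_nonneg (by positivity)]
  have h2 : ((j : ℝ) + 1) ^ (3 / 2 : ℝ) = ((j : ℝ) + 1) * √((j : ℝ) + 1) := by
    rw [Real.sqrt_eq_rpow, ← Real.rpow_one_add' hj.le (by norm_num)]
    norm_num
  have hs : 0 < √((j : ℝ) + 1) := Real.sqrt_pos.2 hj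
  rw [h2, mul_one_div]
  calc |cayleyProd v j| / ((2 * (j : ℝ) + 1) * (2 * j + 1 - v))
      ≤ √((j : ℝ) + 1) / (((j : ℝ) + 1) * (((j : ℝ) + 1) / 2)) := by
        gcongr
        · exact abs_cayleyProd_le hv j
        · linarith
        · exact odd_sub_ge hv j
    _ = 2 / (((j : ℝ) + 1) * √((j : ℝ) + 1)) := by
        have := Real.mul_self_sqrt hj.le
        rw [div_eq_div_iff (by positivity) (by positivity)]
        linear_combination ((j : ℝ) + 1) * this

lemma cayleyProd_sub_two {v : ℝ} (hv : v ≤ 1 / 8) (j : ℕ) :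
    cayleyProd (v - 2) (j + 1) =
      -(1 - v) ^ 2 * cayleyProd v j / ((2 * j + 1 - v) * (2 * j + 3 - v)) := by
  induction j with
  | zero =>
    have : 1 - v ≠ 0 := by linarith
    have : 3 - v ≠ 0 := by linarith
    simp only [cayleyProd_succ, cayleyProd_zero]
    norm_num
    have h3 : 1 - (v - 2) = 3 - v := by ring
    rw [h3]
    field_simp
    ring
  | succ j ih =>
    have h1 := (odd_sub_pos hv j).ne'
    have hj : (0 : ℝ) ≤ j := j.cast_nonneg
    have h2 : 2 * (j : ℝ) + 3 - v ≠ 0 := by linarith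
    have h3 : 2 * (j : ℝ) + 5 - v ≠ 0 := by linarith
    rw [cayleyProd_succ, ih, cayleyProd_succ v]
    push_cast
    have e1 : 2 * ((j : ℝ) + 1) + 1 - (v - 2) = 2 * j + 5 - v := by ring
    have e2 : 2 * ((j : ℝ) + 1) + 1 - v = 2 * j + 3 - v := by ring
    have e3 : 2 * ((j : ℝ) + 1) + 3 - v = 2 * j + 5 - v := by ring
    have e4 : 2 * ((j : ℝ) + 1) + 1 + (v - 2) = 2 * j + 1 + v := by ring
    rw [e1, e2, e3, e4]
    field_simp

/-- A creative-telescoping certificate: the terms of the recurrence for `hyperSum` are the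
differences of the explicit sequence on the right. -/
lemma sum_certificate {v : ℝ} (hv : v ≤ 1 / 8) (N : ℕ) :
    ∑ j ∈ range (N + 1), ((2 - v) ^ 2 * hyperTerm (v - 2) j - (1 - v) ^ 2 * hyperTerm v j) =
      (1 - v) * (N + 1) * cayleyProd v N / ((2 * N + 1 - v) * (2 * N + 3 - v)) := by
  induction N with
  | zero =>
    have : 1 - v ≠ 0 := by linarith
    have : 3 - v ≠ 0 := by linarith
    have h3 : 1 - (v - 2) = 3 - v := by ring
    simp [hyperTerm, cayleyProd_zero, h3]
    field_simp
    ring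
  | succ N ih =>
    have h1 := (odd_sub_pos hv N).ne'
    have hj : (0 : ℝ) ≤ N := N.cast_nonneg
    have h2 : 2 * (N : ℝ) + 3 - v ≠ 0 := by linarith
    have h3 : 2 * (N : ℝ) + 5 - v ≠ 0 := by linarith
    have h4 : 2 * (N : ℝ) + 3 ≠ 0 := by linarith
    rw [sum_range_succ, ih, hyperTerm, hyperTerm, cayleyProd_sub_two hv, cayleyProd_succ v]
    push_cast
    have e1 : 2 * ((N : ℝ) + 1) + 1 - (v - 2) = 2 * N + 5 - v := by ring
    have e2 : 2 * ((N : ℝ) + 1) + 1 - v = 2 * N + 3 - v := by ring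
    have e3 : 2 * ((N : ℝ) + 1) + 3 - v = 2 * N + 5 - v := by ring
    have e4 : 2 * ((N : ℝ) + 1) + 1 = 2 * N + 3 := by ring
    rw [e1, e2, e3, e4]
    generalize ha : 2 * (N : ℝ) + 1 - v = a at h1 ⊢
    generalize hb : 2 * (N : ℝ) + 3 - v = b at h2 ⊢
    generalize hc : 2 * (N : ℝ) + 5 - v = c at h3 ⊢
    generalize hd : 2 * (N : ℝ) + 3 = d at h4 ⊢
    field_simp
    subst ha hb hc hd
    ring

lemma tendsto_certificate {v : ℝ} (hv : v ≤ 1 / 8) :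
    Tendsto (fun N : ℕ => (1 - v) * (N + 1) * cayleyProd v N /
      ((2 * N + 1 - v) * (2 * N + 3 - v))) atTop (𝓝 0) := by
  have hlim : Tendsto (fun N : ℕ => (1 - v) * 4 * (√((N : ℝ) + 1))⁻¹) atTop (𝓝 0) := by
    have h1 : Tendsto (fun N : ℕ => √((N : ℝ) + 1)) atTop atTop :=
      Real.tendsto_sqrt_atTop.comp (tendsto_atTop_add_const_right _ _ tendsto_natCast_atTop_atTop)
    simpa using h1.inv_tendsto_atTop.const_mul ((1 - v) * 4)
  refine squeeze_zero_norm (fun N => ?_) hlim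
  have hj : (0 : ℝ) < (N : ℝ) + 1 := by positivity
  have hd := odd_sub_pos hv N
  have hd2 : ((N : ℝ) + 1) / 2 ≤ 2 * N + 3 - v := by linarith [odd_sub_ge hv N]
  have hd3 : 0 < 2 * (N : ℝ) + 3 - v := by linarith
  have hv1 : 0 ≤ 1 - v := by linarith
  rw [norm_div, norm_mul, Real.norm_of_nonneg (by positivity),
    Real.norm_of_nonneg (by positivity : 0 ≤ (2 * (N : ℝ) + 1 - v) * (2 * N + 3 - v)),
    Real.norm_eq_abs]
  calc (1 - v) * ((N : ℝ) + 1) * |cayleyProd v N| / ((2 * (N : ℝ) + 1 - v) * (2 * N + 3 - v))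
      ≤ (1 - v) * ((N : ℝ) + 1) * √((N : ℝ) + 1) / ((((N : ℝ) + 1) / 2) * (((N : ℝ) + 1) / 2)) := by
        gcongr
        · exact abs_cayleyProd_le hv N
        · exact odd_sub_ge hv N
    _ = _ := by
        have := Real.mul_self_sqrt hj.le
        have hs : 0 < √((N : ℝ) + 1) := Real.sqrt_pos.2 hj
        rw [← div_eq_mul_inv, div_eq_div_iff (by positivity) (by positivity)]
        linear_combination (1 - v) * ((N : ℝ) + 1) * this

lemma hyperSum_recurrence {v : ℝ} (hv : v ≤ 1 / 8) :
    (2 - v) ^ 2 * hyperSum (v - 2) = (1 - v) ^ 2 * hyperSum v := by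
  have h1 := ((summable_hyperTerm (v := v - 2) (by linarith)).hasSum.mul_left ((2 - v) ^ 2)).sub
    ((summable_hyperTerm hv).hasSum.mul_left ((1 - v) ^ 2))
  have h2 := (tendsto_add_atTop_iff_nat 1).2 h1.tendsto_sum_nat
  simp only [sum_certificate hv] at h2
  exact sub_eq_zero.1 (tendsto_nhds_unique h2 (tendsto_certificate hv))

lemma hyperSum_eq_prod_mul {v : ℝ} (hv : v ≤ 1 / 8) (N : ℕ) :
    hyperSum v = (∏ j ∈ range N, ((2 * (j : ℝ) + 2 - v) / (2 * j + 1 - v)) ^ 2) *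
      hyperSum (v - 2 * N) := by
  induction N with
  | zero => simp
  | succ N ih =>
    have hN : (0 : ℝ) ≤ N := N.cast_nonneg
    have h1 := hyperSum_recurrence (v := v - 2 * N) (by linarith)
    have hd := (odd_sub_pos hv N).ne'
    have e : v - 2 * ((N + 1 : ℕ) : ℝ) = v - 2 * N - 2 := by push_cast; ring
    rw [prod_range_succ, mul_assoc, e, ih]
    congr 1
    rw [div_pow, div_mul_eq_mul_div, eq_div_iff (by positivity)]
    linear_combination -h1

/-- Summation by parts. The products alternate in sign as `v → -∞`, and the series of the
`-2 v * hyperTerm v j` has no summable majorant there; the transformed series has one. -/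
lemma sum_hyperTerm_by_parts {v : ℝ} (hv : v ≤ 0) (N : ℕ) :
    ∑ j ∈ range (N + 1), -2 * v * hyperTerm v j = 1 - cayleyProd v (N + 1) / (2 * N + 1) -
      2 * ∑ j ∈ range N, cayleyProd v (j + 1) / ((2 * j + 1) * (2 * j + 3)) := by
  have key : ∀ j, -2 * v * hyperTerm v j =
      (cayleyProd v j - cayleyProd v (j + 1)) / (2 * j + 1) := by
    intro j
    have hd := (odd_sub_pos (v := v) (by linarith) j).ne'
    rw [hyperTerm, cayleyProd_succ]
    field_simp
    ring
  simp only [key]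
  induction N with
  | zero => simp [cayleyProd_zero]
  | succ N ih =>
    rw [sum_range_succ, ih, sum_range_succ]
    push_cast
    have h4 : 2 * ((N : ℝ) + 1) + 1 = 2 * N + 3 := by ring
    rw [h4]
    field_simp
    ring

lemma abs_cayleyProd_le_one {v : ℝ} (hv : v ≤ 0) (j : ℕ) : |cayleyProd v j| ≤ 1 := by
  rw [← sq_le_one_iff_abs_le_one]
  exact cayleyProd_sq_le_one hv j

lemma summable_one_div_odd_mul_odd : Summable fun j : ℕ => 1 / ((2 * (j : ℝ) + 1) * (2 * j + 3)) := by
  have h := (summable_nat_add_iff 1).2 (Real.summable_one_div_nat_pow (p := 2) |>.2 (by norm_num))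
  refine Summable.of_nonneg_of_le (fun j => by positivity) (fun j => ?_) h
  have hj : (0 : ℝ) ≤ j := j.cast_nonneg
  push_cast
  apply one_div_le_one_div_of_le (by positivity)
  nlinarith

lemma norm_cayleyProd_div_le {v : ℝ} (hv : v ≤ 0) (j : ℕ) :
    ‖cayleyProd v (j + 1) / ((2 * (j : ℝ) + 1) * (2 * j + 3))‖ ≤
      1 / ((2 * (j : ℝ) + 1) * (2 * j + 3)) := by
  rw [norm_div, Real.norm_of_nonneg (by positivity : 0 ≤ (2 * (j : ℝ) + 1) * (2 * j + 3))]
  gcongr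
  exact abs_cayleyProd_le_one hv _

lemma hyperSum_by_parts {v : ℝ} (hv : v ≤ 0) :
    -2 * v * hyperSum v =
      1 - 2 * ∑' j : ℕ, cayleyProd v (j + 1) / ((2 * (j : ℝ) + 1) * (2 * j + 3)) := by
  have h1 := (tendsto_add_atTop_iff_nat 1).2
    ((summable_hyperTerm (v := v) (by linarith)).hasSum.mul_left (-2 * v)).tendsto_sum_nat
  have h2 : Summable fun j : ℕ => cayleyProd v (j + 1) / ((2 * (j : ℝ) + 1) * (2 * j + 3)) :=
    Summable.of_norm_bounded summable_one_div_odd_mul_odd (norm_cayleyProd_div_le hv)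
  have h3 : Tendsto (fun N : ℕ => cayleyProd v (N + 1) / (2 * (N : ℝ) + 1)) atTop (𝓝 0) := by
    have hlim : Tendsto (fun N : ℕ => 1 / ((N : ℝ) + 1)) atTop (𝓝 0) :=
      tendsto_one_div_add_atTop_nhds_zero_nat
    refine squeeze_zero_norm (fun N => ?_) hlim
    rw [norm_div, Real.norm_of_nonneg (by positivity : 0 ≤ 2 * (N : ℝ) + 1)]
    have hN : (0 : ℝ) ≤ N := N.cast_nonneg
    gcongr
    · exact abs_cayleyProd_le_one hv _
    · linarith
  simp only [sum_hyperTerm_by_parts hv] at h1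
  refine tendsto_nhds_unique h1 ?_
  simpa using (h3.const_sub 1).sub (h2.hasSum.tendsto_sum_nat.const_mul 2)

lemma tendsto_cayleyProd_atBot (j : ℕ) :
    Tendsto (fun v => cayleyProd v j) atBot (𝓝 ((-1) ^ j)) := by
  induction j with
  | zero => simp [cayleyProd_zero]
  | succ j ih =>
    simp only [cayleyProd_succ, pow_succ]
    refine ih.mul ?_
    have h1 : Tendsto (fun v : ℝ => 2 * (2 * (j : ℝ) + 1) / (2 * j + 1 - v)) atBot (𝓝 0) := by
      refine Tendsto.const_div_atTop ?_ _
      exact tendsto_atTop_add_const_left _ _ tendsto_neg_atBot_atTop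
    have h2 := h1.sub_const 1
    rw [zero_sub] at h2
    refine h2.congr' ?_
    filter_upwards [eventually_le_atBot 0] with v hv
    have hd := (odd_sub_pos (v := v) (by linarith) j).ne'
    field_simp
    ring

lemma exists_tendsto_hyperSum : ∃ L, Tendsto (fun v => -2 * v * hyperSum v) atBot (𝓝 L) := by
  refine ⟨1 - 2 * ∑' j : ℕ, (-1) ^ (j + 1) / ((2 * (j : ℝ) + 1) * (2 * j + 3)), ?_⟩
  have h := tendsto_tsum_of_dominated_convergence (𝓕 := atBot)
    (f := fun v (j : ℕ) => cayleyProd v (j + 1) / ((2 * (j : ℝ) + 1) * (2 * j + 3)))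
    summable_one_div_odd_mul_odd (fun j => (tendsto_cayleyProd_atBot (j + 1)).div_const _)
    ((eventually_le_atBot 0).mono fun v hv => norm_cayleyProd_div_le hv)
  refine ((h.const_mul 2).const_sub 1).congr' ?_
  filter_upwards [eventually_le_atBot 0] with v hv
  exact (hyperSum_by_parts hv).symm

lemma hyperTerm_zero (j : ℕ) : hyperTerm 0 j = recip 1 j ^ 2 := by
  have h : ∀ j, cayleyProd 0 j = 1 := fun j => prod_eq_one fun i _ => by
    rw [add_zero, sub_zero, div_self]
    positivity
  simp [hyperTerm, h, recip, pow_two]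

lemma hyperSum_zero : hyperSum 0 = t 2 := by
  rw [t_eq_tsum, hyperSum]
  exact tsum_congr hyperTerm_zero

lemma hyperSum_zero_pos : 0 < hyperSum 0 := by
  refine (summable_hyperTerm (by norm_num)).tsum_pos (fun j => ?_) 0 ?_
  · rw [hyperTerm_zero]
    positivity
  · simp [hyperTerm_zero, recip]

/-- By the recurrence `2 k * hyperSum (-2 k)` increases with `k`, so its limit is positive. -/
lemma le_hyperSum_neg_even (N : ℕ) :
    hyperSum 0 / 2 ≤ 2 * (N + 1 : ℝ) * hyperSum (-(2 * (N + 1 : ℝ))) := by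
  induction N with
  | zero =>
    have h := hyperSum_recurrence (v := 0) (by norm_num)
    norm_num at h ⊢
    linarith
  | succ N ih =>
    refine ih.trans ?_
    have hN : (0 : ℝ) ≤ N := N.cast_nonneg
    have h := hyperSum_recurrence (v := -(2 * (N + 1 : ℝ))) (by linarith)
    have e : -(2 * ((N : ℝ) + 1)) - 2 = -(2 * (((N + 1 : ℕ) : ℝ) + 1)) := by push_cast; ring
    rw [e] at h
    push_cast at h ⊢
    have h0 : 0 < hyperSum (-(2 * (N + 1 : ℝ))) := by
      have := hyperSum_zero_pos.trans_le (by linarith : hyperSum 0 ≤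
        2 * (2 * (N + 1 : ℝ) * hyperSum (-(2 * (N + 1 : ℝ)))))
      by_contra hneg
      nlinarith
    set A := hyperSum (-(2 * (N + 1 : ℝ)))
    set B := hyperSum (-(2 * ((N : ℝ) + 1 + 1)))
    have h2 : B = (2 * N + 3) ^ 2 * A / (2 * N + 4) ^ 2 := by
      rw [eq_div_iff (by positivity)]
      linear_combination h
    rw [h2, ← mul_div_assoc, le_div_iff₀ (by positivity)]
    nlinarith [mul_nonneg h0.le hN]

/-- Iterating the recurrence at `v` and at `0` and dividing, the remaining factors
`hyperSum (v - 2 N)` and `hyperSum (-2 N)` have the same asymptotics, so that their quotient tends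
to `1`. -/
lemma tendsto_prod_hyperSum {v : ℝ} (hv : v ≤ 1 / 8) :
    Tendsto (fun N : ℕ => ∏ j ∈ range N,
      ((1 - v / (2 * (j : ℝ) + 2)) / (1 - v / (2 * j + 1))) ^ 2) atTop
      (𝓝 (hyperSum v / hyperSum 0)) := by
  obtain ⟨L, hL⟩ := exists_tendsto_hyperSum
  have hbot : ∀ w : ℝ, Tendsto (fun N : ℕ => w - 2 * (N : ℝ)) atTop atBot := by
    intro w
    have : Tendsto (fun N : ℕ => 2 * (N : ℝ)) atTop atTop :=
      tendsto_natCast_atTop_atTop.const_mul_atTop (by norm_num)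
    simpa [sub_eq_add_neg] using
      tendsto_atBot_add_const_left _ w (tendsto_neg_atTop_atBot.comp this)
  have hLpos : 0 < L := by
    have h1 := (tendsto_add_atTop_iff_nat 1).2 (hL.comp (hbot 0))
    refine hyperSum_zero_pos.trans_le (ge_of_tendsto' h1 fun N => ?_)
    have := le_hyperSum_neg_even N
    simp only [Function.comp_apply]
    push_cast
    rw [zero_sub]
    linarith
  have h1 := hL.comp (hbot v)
  have h2 := hL.comp (hbot 0)
  have h3 : Tendsto (fun N : ℕ => 1 - v / (2 * (N : ℝ))) atTop (𝓝 1) := by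
    have : Tendsto (fun N : ℕ => 2 * (N : ℝ)) atTop atTop :=
      tendsto_natCast_atTop_atTop.const_mul_atTop (by norm_num)
    simpa using (this.const_div_atTop v).const_sub 1
  have h4 := ((h2.const_mul (hyperSum v / hyperSum 0)).mul h3).div h1 hLpos.ne'
  have h5 : hyperSum v / hyperSum 0 * L * 1 / L = hyperSum v / hyperSum 0 := by
    field_simp
  rw [h5] at h4
  refine h4.congr' ?_
  have hne : ∀ᶠ N : ℕ in atTop, -2 * (v - 2 * (N : ℝ)) * hyperSum (v - 2 * N) ≠ 0 :=
    h1.eventually_ne hLpos.ne'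
  filter_upwards [hne, eventually_ge_atTop 1] with N hN hN1
  have hN1' : (1 : ℝ) ≤ N := by exact_mod_cast hN1
  have e1 := hyperSum_eq_prod_mul hv N
  have e2 := hyperSum_eq_prod_mul (v := 0) (by norm_num) N
  set R := ∏ j ∈ range N, ((2 * (j : ℝ) + 2 - v) / (2 * j + 1 - v)) ^ 2 with hR
  set R0 := ∏ j ∈ range N, ((2 * (j : ℝ) + 2 - 0) / (2 * j + 1 - 0)) ^ 2 with hR0
  have hprod : ∏ j ∈ range N, ((1 - v / (2 * (j : ℝ) + 2)) / (1 - v / (2 * j + 1))) ^ 2 =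
      R / R0 := by
    rw [hR, hR0, ← prod_div_distrib]
    refine prod_congr rfl fun j _ => ?_
    have hd := (odd_sub_pos hv j).ne'
    rw [← div_pow]
    congr 1
    rw [sub_zero, sub_zero, one_sub_div (by positivity), one_sub_div (by positivity)]
    field_simp
  have hR0pos : R0 ≠ 0 := by
    rw [hR0]
    refine prod_ne_zero_iff.2 fun j _ => ?_
    rw [sub_zero, sub_zero]
    positivity
  have hz := hyperSum_zero_pos.ne'
  have hw : v - 2 * (N : ℝ) ≠ 0 := by
    intro h
    simp [h] at hN
  have hF : hyperSum (v - 2 * (N : ℝ)) ≠ 0 := right_ne_zero_of_mul hN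
  rw [hprod]
  simp only [Function.comp_apply, Pi.div_apply]
  rw [div_eq_div_iff hN hR0pos, e1]
  have e3 : hyperSum (0 - 2 * (N : ℝ)) = hyperSum 0 / R0 := by
    rw [eq_div_iff hR0pos]
    linear_combination -e2
  rw [e3]
  field_simp
  ring

/-! ### Alternating sums and the exponent -/

lemma summable_recip_pow {n : ℕ} (hn : 2 ≤ n) : Summable fun j => recip 1 j ^ n := by
  have h := (summable_nat_add_iff 1).2
    (Real.summable_one_div_nat_pow (p := 2) |>.2 (by norm_num))
  refine Summable.of_nonneg_of_le (fun j => pow_nonneg (recip_nonneg _ _) _) (fun j => ?_) h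
  refine (pow_le_pow_of_le_one (recip_nonneg _ _) (recip_le_one _ _ le_rfl) hn).trans ?_
  have := pow_le_pow_left₀ (recip_nonneg 1 j) (recip_le 1 j le_rfl) 2
  simpa using this

lemma hasSum_t {n : ℕ} (hn : 2 ≤ n) : HasSum (fun j => recip 1 j ^ n) (t n) := by
  rw [t_eq_tsum]
  exact (summable_recip_pow hn).hasSum

lemma t_nonneg (n : ℕ) : 0 ≤ t n := by
  rw [t_eq_tsum]
  exact tsum_nonneg fun j => pow_nonneg (recip_nonneg _ _) _

lemma t_le_t_two {n : ℕ} (hn : 2 ≤ n) : t n ≤ t 2 :=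
  hasSum_le (fun _ => pow_le_pow_of_le_one (recip_nonneg _ _) (recip_le_one _ _ le_rfl) hn)
    (hasSum_t hn) (hasSum_t le_rfl)

/-- The value `∑ⱼ (1 / (2 j + 1)ⁿ - 1 / (2 j + 2)ⁿ)` of the alternating zeta function at `n`. -/
noncomputable def altZeta (n : ℕ) : ℝ :=
  if n = 1 then Real.log 2 else 2 * (2 ^ (n - 1) - 1) / (2 ^ n - 1) * t n

lemma hasSum_altZeta_one :
    HasSum (fun j : ℕ => 1 / (2 * (j : ℝ) + 1) - 1 / (2 * j + 2)) (Real.log 2) := by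
  rw [hasSum_iff_tendsto_nat_of_nonneg]
  swap
  · intro j
    exact sub_nonneg.2 (one_div_le_one_div_of_le (by positivity) (by linarith))
  have hsum : ∀ N : ℕ, ∑ j ∈ range N, (1 / (2 * (j : ℝ) + 1) - 1 / (2 * j + 2)) =
      (harmonic (2 * N) : ℝ) - harmonic N := by
    intro N
    induction N with
    | zero => simp
    | succ N ih =>
      rw [sum_range_succ, ih, show 2 * (N + 1) = 2 * N + 1 + 1 by ring, harmonic_succ,
        harmonic_succ, harmonic_succ]
      push_cast
      field_simp
      ring
  simp only [hsum]
  have h1 := Real.tendsto_harmonic_sub_log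
  have h2 := h1.comp (tendsto_id.const_mul_atTop' (by norm_num : 0 < 2))
  have h3 := (h2.sub h1).add_const (Real.log 2)
  rw [sub_self, zero_add] at h3
  refine h3.congr' ?_
  filter_upwards [eventually_ge_atTop 1] with N hN
  have hN' : (N : ℝ) ≠ 0 := by positivity
  simp only [Function.comp_apply, id_eq]
  push_cast
  rw [Real.log_mul (by norm_num) hN']
  ring

/-- For `n ≥ 2` the even part of `ζ(n)` is `ζ(n) / 2ⁿ`, which expresses it through `t n`. -/
lemma hasSum_altZeta {n : ℕ} (hn : 1 ≤ n) :
    HasSum (fun j : ℕ => (1 / (2 * (j : ℝ) + 1)) ^ n - (1 / (2 * (j : ℝ) + 2)) ^ n)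
      (altZeta n) := by
  rcases eq_or_ne n 1 with rfl | h1
  · simpa [altZeta] using hasSum_altZeta_one
  have h2 : 2 ≤ n := by omega
  have hodd : HasSum (fun j : ℕ => (1 / (2 * (j : ℝ) + 1)) ^ n) (t n) := by
    simpa [recip] using hasSum_t h2
  obtain ⟨Z, hZ⟩ : Summable fun j : ℕ => (1 / ((j : ℝ) + 1)) ^ n := by
    have h := (summable_nat_add_iff 1).2 (Real.summable_one_div_nat_pow (p := n) |>.2 (by omega))
    simpa using h
  have heven : HasSum (fun j : ℕ => (1 / (2 * (j : ℝ) + 2)) ^ n) ((1 / 2) ^ n * Z) := by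
    refine (congrArg (HasSum · _) (funext fun j => ?_)).mpr (hZ.mul_left ((1 / 2) ^ n))
    rw [← mul_pow]
    congr 1
    field_simp
  have hZ2 : Z = t n + (1 / 2) ^ n * Z := by
    refine hZ.unique (HasSum.even_add_odd ?_ ?_)
    · simpa using hodd
    · refine (congrArg (HasSum · _) (funext fun j => ?_)).mpr heven
      push_cast
      ring
  refine (congrArg (HasSum _ ·) ?_).mpr (hodd.sub heven)
  obtain ⟨m, rfl⟩ := Nat.exists_eq_add_of_le' hn
  have h3 : (1 : ℝ) < 2 ^ (m + 1) := one_lt_pow₀ (by norm_num) (by omega)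
  have h4 : (2 : ℝ) ^ (m + 1) - 1 ≠ 0 := by linarith
  have h5 : (1 / 2 : ℝ) ^ (m + 1) * 2 ^ (m + 1) = 1 := by
    rw [← mul_pow]
    norm_num
  rw [altZeta, if_neg h1, Nat.add_sub_cancel, div_mul_eq_mul_div, div_eq_iff h4]
  have h6 : (2 : ℝ) * 2 ^ m = 2 ^ (m + 1) := by ring
  linear_combination t (m + 1) * h6 + Z * h5 + hZ2

lemma constantCoeff_exponentSeries (a : ℕ) : constantCoeff (exponentSeries a) = 0 := by
  simp [exponentSeries, ← coeff_zero_eq_constantCoeff_apply]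

lemma exists_evalsTo_exponentSeries {a : ℕ} (ha : 1 ≤ a) {u : ℝ} (h0 : 0 ≤ u)
    (hu : u ≤ 1 / 8) : ∃ e, EvalsTo (exponentSeries a) u e := by
  have ha' : (1 : ℝ) ≤ a := by exact_mod_cast ha
  have hc : ∀ n, 0 ≤ coeff n (exponentSeries a) ∧ coeff n (exponentSeries a) ≤ 4 * t 2 := by
    intro n
    rw [exponentSeries, coeff_mk]
    split_ifs with hn
    swap
    · exact ⟨le_rfl, by linarith [t_nonneg 2]⟩
    have h1 : (1 : ℝ) ≤ 2 ^ (n - 1) := one_le_pow₀ (by norm_num)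
    have h2 : (2 : ℝ) ^ (n - 1) ≤ 2 ^ n := pow_le_pow_right₀ (by norm_num) (Nat.sub_le n 1)
    have h2' : (1 : ℝ) < 2 ^ n := one_lt_pow₀ (by norm_num) (by omega)
    have h3 : (1 : ℝ) ≤ n * a ^ n :=
      one_le_mul_of_one_le_of_one_le (by exact_mod_cast (by omega : 1 ≤ n)) (one_le_pow₀ ha')
    have h4 : 0 < (n : ℝ) * a ^ n * (2 ^ n - 1) := mul_pos (by linarith) (by linarith)
    refine ⟨mul_nonneg (div_nonneg (by linarith) h4.le) (t_nonneg n), ?_⟩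
    refine mul_le_mul ?_ (t_le_t_two hn) (t_nonneg n) (by norm_num)
    rw [div_le_iff₀ h4]
    nlinarith
  have hs : Summable fun n => coeff n (exponentSeries a) * u ^ n := by
    refine Summable.of_nonneg_of_le (fun n => mul_nonneg (hc n).1 (by positivity))
      (fun n => mul_le_mul_of_nonneg_right (hc n).2 (by positivity))
      ((summable_geometric_of_lt_one h0 (by linarith)).mul_left _)
  exact ⟨_, fun n => (hc n).1, hs.hasSum⟩

/-- The linear term of the exponent comes from `altZeta 1 = log 2`, the others from `t n`. For
`n = 0` both sides vanish, the right one because of the division by zero. -/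
lemma coeff_exponent_mul_pow {a : ℕ} (ha : 1 ≤ a) (u : ℝ) (n : ℕ) :
    coeff n (C (2 / (a : ℝ) * Real.log 2) * X + exponentSeries a) * u ^ n =
      2 * (u / a) ^ n / n * altZeta n := by
  have ha' : (a : ℝ) ≠ 0 := by positivity
  rw [map_add, coeff_C_mul, coeff_X, exponentSeries, coeff_mk]
  rcases Nat.lt_or_ge n 2 with h | h
  · interval_cases n
    · simp
    · simp [altZeta]
      ring
  · have h1 : n ≠ 1 := by omega
    rw [if_neg h1, if_pos h, altZeta, if_neg h1, div_pow, mul_zero, zero_add]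
    generalize (2 : ℝ) ^ n - 1 = w
    ring

lemma hasSum_log_sub_log {v : ℝ} (h0 : 0 ≤ v) (hv : v ≤ 1 / 8) (j : ℕ) :
    HasSum (fun n : ℕ => 2 * v ^ n / n *
      ((1 / (2 * (j : ℝ) + 1)) ^ n - (1 / (2 * (j : ℝ) + 2)) ^ n))
      (2 * (Real.log (1 - v / (2 * j + 2)) - Real.log (1 - v / (2 * j + 1)))) := by
  have key : ∀ y : ℝ, 1 ≤ y → HasSum (fun n : ℕ => v ^ n / n * (1 / y) ^ n)
      (-Real.log (1 - v / y)) := by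
    intro y hy
    have h1 : |v / y| < 1 := by
      rw [abs_of_nonneg (by positivity), div_lt_one (by linarith)]
      linarith
    rw [← hasSum_nat_add_iff' 1]
    refine (congrArg₂ HasSum (funext fun n => ?_) ?_).mpr
      (Real.hasSum_pow_div_log_of_abs_lt_one h1)
    · push_cast
      rw [div_pow, div_pow, one_pow]
      ring
    · simp
  have hj : (0 : ℝ) ≤ j := j.cast_nonneg
  have h := ((key (2 * j + 1) (by linarith)).sub (key (2 * j + 2) (by linarith))).mul_left 2
  refine (congrArg₂ HasSum (funext fun n => ?_) ?_).mpr h <;> ring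

/-- The logarithm of the infinite product for `hyperSum v / hyperSum 0`, expanded in powers of `v`,
has the alternating zeta values as coefficients. -/
lemma hyperSum_eq_exp {a : ℕ} (ha : 1 ≤ a) {u e : ℝ} (h0 : 0 ≤ u) (hu : u ≤ 1 / 8)
    (he : EvalsTo (exponentSeries a) u e) :
    hyperSum (u / a) = t 2 * (Real.exp (2 / (a : ℝ) * Real.log 2 * u) * Real.exp e) := by
  have ha' : (1 : ℝ) ≤ a := by exact_mod_cast ha
  set v := u / a with hvdef
  have hv0 : 0 ≤ v := by positivity
  have hv : v ≤ 1 / 8 := (div_le_self h0 ha').trans hu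
  have hS := ((EvalsTo.const_mul_X (c := 2 / (a : ℝ) * Real.log 2)
    (mul_nonneg (by positivity) (Real.log_nonneg (by norm_num))) u).add he).2
  simp only [coeff_exponent_mul_pow ha] at hS
  rw [← hvdef] at hS
  have hlog := hasSum_swap (g := fun n j => 2 * v ^ n / n *
      ((1 / (2 * (j : ℝ) + 1)) ^ n - (1 / (2 * (j : ℝ) + 2)) ^ n)) (fun n j => ?_) (fun n => ?_) hS
      (hasSum_log_sub_log hv0 hv)
  · have hexp := (Real.continuous_exp.tendsto _).comp hlog.tendsto_sum_nat
    have hprod := tendsto_prod_hyperSum hv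
    have heq : hyperSum v / hyperSum 0 = Real.exp (2 / (a : ℝ) * Real.log 2 * u + e) := by
      refine tendsto_nhds_unique hprod (hexp.congr fun N => ?_)
      rw [Function.comp_apply, Real.exp_sum]
      refine prod_congr rfl fun j _ => ?_
      have hj : (0 : ℝ) ≤ j := j.cast_nonneg
      have h1 : 0 < 1 - v / (2 * (j : ℝ) + 2) := by
        rw [sub_pos, div_lt_one (by positivity)]
        linarith
      have h2 : 0 < 1 - v / (2 * (j : ℝ) + 1) := by
        rw [sub_pos, div_lt_one (by positivity)]
        linarith
      rw [← Real.log_div h1.ne' h2.ne', two_mul, Real.exp_add, Real.exp_log (div_pos h1 h2), sq]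
    rw [div_eq_iff hyperSum_zero_pos.ne', hyperSum_zero] at heq
    rw [heq, Real.exp_add]
    ring
  · refine mul_nonneg (by positivity) (sub_nonneg.2 ?_)
    gcongr
    norm_num
  · rcases Nat.eq_zero_or_pos n with rfl | hn
    · simp
    · exact (hasSum_altZeta hn).mul_left _

/-! ### The generating function -/

lemma evalsTo_layer {a : ℕ} (ha : 1 ≤ a) {u : ℝ} (h0 : 0 ≤ u) (hu : u ≤ 1 / 8) (j : ℕ) :
    EvalsTo (layer a j) u (((a : ℝ) ^ 2)⁻¹ * hyperTerm (u / a) j) := by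
  have ha' : (1 : ℝ) ≤ a := by exact_mod_cast ha
  have hv : u / a ≤ 1 / 8 := (div_le_self h0 ha').trans hu
  have hx : ∀ i, recip a i * u < 1 := fun i =>
    (mul_le_of_le_one_left h0 (recip_le_one a i ha)).trans_lt (by linarith)
  have h := ((EvalsTo.const (sq_nonneg (recip a j)) u).mul
    (evalsTo_geom (recip_nonneg a j) h0 (hx j))).mul
    (EvalsTo.prod (fun i => evalsTo_cayley (recip_nonneg a i) h0 (hx i)) j)
  have hval : recip a j ^ 2 * (1 - recip a j * u)⁻¹ *
      ∏ i ∈ range j, (1 + recip a i * u) / (1 - recip a i * u) =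
      ((a : ℝ) ^ 2)⁻¹ * hyperTerm (u / a) j := by
    have hw : ∀ i : ℕ, recip a i * u = u / a / (2 * i + 1) := by
      intro i
      rw [recip]
      field_simp
    have hd := (odd_sub_pos hv j).ne'
    simp only [hw]
    have hp : ∏ i ∈ range j, (1 + u / a / (2 * (i : ℝ) + 1)) / (1 - u / a / (2 * i + 1)) =
        cayleyProd (u / a) j := by
      refine prod_congr rfl fun i _ => ?_
      have hd := (odd_sub_pos hv i).ne'
      rw [one_add_div (by positivity), one_sub_div (by positivity)]
      field_simp
    rw [hp, hyperTerm, recip, one_sub_div (by positivity)]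
    generalize u / (a : ℝ) = v at hd ⊢
    field_simp
  rw [← hval]
  exact h

/-- The generating function of a family whose members are the sums of the coefficients of the
layers takes the values of `hyperSum`. -/
lemma hasSum_generating {a : ℕ} (ha : 1 ≤ a) {c : ℕ → ℝ}
    (hc : ∀ d, HasSum (fun j => coeff d (layer a j)) (c (d + 2))) {u : ℝ} (h0 : 0 ≤ u)
    (hu : u ≤ 1 / 8) :
    HasSum (fun d => coeff d (genFun c) * u ^ d) (((a : ℝ) ^ 2)⁻¹ * hyperSum (u / a)) := by
  have ha' : (1 : ℝ) ≤ a := by exact_mod_cast ha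
  have hv : u / a ≤ 1 / 8 := (div_le_self h0 ha').trans hu
  refine hasSum_swap (g := fun j d => coeff d (layer a j) * u ^ d)
    (fun j d => mul_nonneg ((evalsTo_layer ha h0 hu j).1 d) (by positivity))
    (fun j => (evalsTo_layer ha h0 hu j).2) ((summable_hyperTerm hv).hasSum.mul_left _)
    fun d => ?_
  rw [genFun, coeff_mk]
  exact (hc d).mul_right _

lemma hasSum_closedForm {a : ℕ} (ha : 1 ≤ a) {u : ℝ} (h0 : 0 ≤ u) (hu : u ≤ 1 / 8) :
    HasSum (fun d => coeff d (C (((a : ℝ) ^ 2)⁻¹ * t 2) * formalPow 2 (2 / (a : ℝ)) *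
      formalExp (exponentSeries a)) * u ^ d) (((a : ℝ) ^ 2)⁻¹ * hyperSum (u / a)) := by
  obtain ⟨e, he⟩ := exists_evalsTo_exponentSeries ha h0 hu
  have h1 := (EvalsTo.const_mul_X (c := 2 / (a : ℝ) * Real.log 2)
    (mul_nonneg (by positivity) (Real.log_nonneg (by norm_num))) u).formalExp h0 (by simp)
  have h2 := ((EvalsTo.const (c := ((a : ℝ) ^ 2)⁻¹ * t 2)
    (mul_nonneg (by positivity) (t_nonneg 2)) u).mul h1).mul
    (he.formalExp h0 (constantCoeff_exponentSeries a))
  rw [hyperSum_eq_exp ha h0 hu he]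
  refine (congrArg (HasSum _ ·) ?_).mpr h2.2
  ring

/-! ### The coefficients of the closed form -/

lemma coeff_pow_eq_sum_antidiagonalTuple (φ : PowerSeries ℝ) (m q : ℕ) :
    coeff q (φ ^ m) = ∑ p ∈ Nat.antidiagonalTuple m q, ∏ i, coeff (p i) φ := by
  induction m generalizing q with
  | zero => cases q <;> simp [coeff_one]
  | succ m ih =>
    rw [pow_succ', coeff_mul, sum_antidiagonalTuple_succ]
    refine sum_congr rfl fun p _ => ?_
    rw [ih, mul_sum]
    simp [Fin.prod_univ_succ]

lemma coeff_formalPow (x c : ℝ) (n : ℕ) :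
    coeff n (formalPow x c) = (c * Real.log x) ^ n / n.factorial := by
  rw [formalPow, coeff_formalExp (by simp) (Nat.lt_succ_self n), sum_range_succ, sum_eq_zero]
  · rw [mul_pow, ← map_pow, coeff_C_mul, coeff_X_pow_self]
    ring
  · intro m hm
    rw [mul_pow, ← map_pow, coeff_C_mul, coeff_X_pow, if_neg (mem_range.1 hm).ne']
    ring

lemma coeff_exponentSeries_pow (a m q : ℕ) :
    coeff q (exponentSeries a ^ m) =
      ∑ p ∈ (Nat.antidiagonalTuple m q).filter fun p => ∀ i, 2 ≤ p i,
        2 ^ (2 * m) * (∏ i, ((2 : ℝ) ^ (p i - 1) - 1)) /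
          ((a : ℝ) ^ q * (∏ i, (p i : ℝ)) * ∏ i, ((2 : ℝ) ^ p i - 1)) * ∏ i, t (p i) := by
  rw [coeff_pow_eq_sum_antidiagonalTuple, sum_filter]
  refine sum_congr rfl fun p hp => ?_
  rw [Nat.mem_antidiagonalTuple] at hp
  split_ifs with h
  · simp only [exponentSeries, coeff_mk, h, if_true, prod_mul_distrib, prod_div_distrib,
      prod_const, card_univ, Fintype.card_fin, prod_pow_eq_pow_sum, hp]
    have h4 : (4 : ℝ) ^ m = 2 ^ (2 * m) := by
      rw [pow_mul]
      norm_num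
    rw [h4]
    ring
  · push Not at h
    obtain ⟨i, hi⟩ := h
    exact prod_eq_zero (mem_univ i) (by simp [exponentSeries, hi])

lemma coeff_closedForm (a d : ℕ) :
    coeff d (C (((a : ℝ) ^ 2)⁻¹ * t 2) * formalPow 2 (2 / (a : ℝ)) *
      formalExp (exponentSeries a)) = explicitSum a (d + 2) := by
  rw [mul_assoc, coeff_C_mul, coeff_mul, Nat.sum_antidiagonal_eq_sum_range_succ_mk, mul_sum,
    explicitSum]
  refine sum_congr rfl fun n hn => ?_
  have hn' : n ≤ d := Nat.lt_succ_iff.1 (mem_range.1 hn)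
  rw [coeff_formalPow, coeff_formalExp (constantCoeff_exponentSeries a)
    (by omega : d - n < d + 2 - 1), mul_sum, mul_sum]
  refine sum_congr rfl fun m _ => ?_
  rw [coeff_exponentSeries_pow, mul_sum, mul_sum, mul_sum]
  refine sum_congr rfl fun p _ => ?_
  obtain ⟨q, rfl⟩ := Nat.exists_eq_add_of_le hn'
  have : n + q - n = q := by omega
  rw [this]
  ring

end MultipleT

theorem mainTheorem7 (a : ℕ) (ha : 1 ≤ a) :
    (∀ (n : ℕ) (s : Fin n → ℕ), MultipleT.IsAdmissible s →
      Summable (fun m : MultipleT.strictTuples (2 * a) a n => MultipleT.term s m.1) ∧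
      Summable (fun m : MultipleT.weakTuples (2 * a) a n => MultipleT.term s m.1)) ∧
    MultipleT.genFun (MultipleT.weightedSum a) =
      MultipleT.genFun (MultipleT.weightedStarSum a) ∧
    MultipleT.genFun (MultipleT.weightedSum a) =
      PowerSeries.C (((a : ℝ) ^ 2)⁻¹ * MultipleT.t 2) * MultipleT.formalPow 2 (2 / (a : ℝ)) *
        MultipleT.formalExp (MultipleT.exponentSeries a) ∧
    ∀ k : ℕ, 2 ≤ k →
      MultipleT.weightedSum a k = MultipleT.weightedStarSum a k ∧
      MultipleT.weightedSum a k = MultipleT.explicitSum a k := by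
  have hstar : ∀ d, MultipleT.weightedSum a (d + 2) = MultipleT.weightedStarSum a (d + 2) :=
    fun d => (MultipleT.hasSum_weightedSum ha d).unique (MultipleT.hasSum_weightedStarSum ha d)
  have hgen := MultipleT.eq_of_hasSum_eq (r := 1 / 8) (by norm_num)
    (fun u h0 hu => MultipleT.hasSum_generating ha (MultipleT.hasSum_weightedSum ha) h0 hu)
    (fun u h0 hu => MultipleT.hasSum_closedForm ha h0 hu)
  refine ⟨fun n s hs => ⟨?_, ?_⟩, ?_, hgen, fun k hk => ?_⟩
  · rw [MultipleT.strictTuples_eq ha]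
    exact (MultipleT.summable_image_iff ha s _).2
      (MultipleT.summable_indicator ha zero_le_one s hs)
  · rw [MultipleT.weakTuples_eq ha]
    exact (MultipleT.summable_image_iff ha s _).2
      (MultipleT.summable_indicator ha le_rfl s hs)
  · ext d
    simpa [MultipleT.genFun] using hstar d
  · obtain ⟨d, rfl⟩ := Nat.exists_eq_add_of_le' hk
    refine ⟨hstar d, ?_⟩
    rw [← MultipleT.coeff_closedForm, ← hgen]
    simp [MultipleT.genFun]
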